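/- Let $\zeta_3$ be a primitive cube root of unity. Every element of $\mathbb{Z}[\zeta_{12}]=\mathbb{Z}[\zeta_3,i]$ is uniquely of the form $r+is$ with $r,s\in\mathbb{Z}[\zeta_3]$. Call $z\in\mathbb{Z}[\zeta_{12}]$ *primary* if $z\equiv\pm1 \pmod 3$ in $\mathbb{Z}[\zeta_{12}]$, and call $w=u+iv$ (with $u,v\in\mathbb{Z}[\zeta_3]$) *primitive* if $u$ and $v$ are coprime in $\mathbb{Z}[\zeta_3]$. For $a\in\mathbb{Z}[\zeta_3]$ and a prime $\pi\in\mathbb{Z}[\zeta_3]$ with $\pi\nmid 3$, let the cubic residue character $\left[\frac{a}{\pi}\right]$ be $0$ if $\pi\mid a$, and otherwise the unique $\xi\in\{1,\zeta_3,\zeta_3^2\}$ with $a^{(N\pi-1)/3}\equiv\xi \pmod{\pi}$, where $N$ is the norm of $\mathbb{Q}(\zeta_3)/\mathbb{Q}$; if $\pi\mid 3$, put $\left[\frac{a}{\pi}\right]=1$. For nonzero $\lambda=\mu\,\pi_1\cdots\pi_m$ with $\mu$ a unit and $\pi_j$ primes (repetitions allowed), put $\left[\frac{a}{\lambda}\right]=\prod_{j=1}^m\left[\frac{a}{\pi_j}\right]$.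 The *cubic spin* of a primary $z=r+is$ is $[z]=\left[\frac{s}{r}\right]$. For $w=u+iv$ primary and primitive and $z=r+is$, put $$\left(\frac{z}{w}\right)=\left[\frac{r+\omega s}{u^2+v^2}\right],\qquad \omega\equiv -vu^{-1}\pmod{u^2+v^2},$$ where $u^{-1}$ is an inverse of $u$ modulo $u^2+v^2$. 1. If $w,z\in\mathbb{Z}[\zeta_{12}]$ are primary and $w$ is primitive, then $$[wz]=[w]\,[z]\left(\frac{z}{w}\right).$$ 2. If $w,z\in\mathbb{Z}[\zeta_{12}]$ are both primary and primitive, then $\left(\frac{z}{w}\right)=\left(\frac{w}{z}\right)$. -/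

import Mathlib

namespace CubicSpin

open NumberField

/-- The Eisenstein integers `ℤ[ζ₃]`. -/
abbrev ZZeta3 : Type := 𝓞 (CyclotomicField 3 ℚ)

/-- The ring `ℤ[ζ₁₂] = ℤ[ζ₃][i]`: its elements are `r + i s` with `r, s : ℤ[ζ₃]`
(`r = z.re`, `s = z.im`), multiplied by the rule `i ^ 2 = -1`. -/
abbrev ZZeta12 : Type := QuadraticAlgebra ZZeta3 (-1) 0

instance instIsCyclotomicExtensionThree : IsCyclotomicExtension {3} ℚ (CyclotomicField 3 ℚ) :=
  have : NeZero ((3 : ℕ) : ℚ) := ⟨by norm_num⟩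
  CyclotomicField.isCyclotomicExtension 3 ℚ

instance instIsPrincipalIdealRingZZeta3 : IsPrincipalIdealRing ZZeta3 :=
  IsCyclotomicExtension.Rat.three_pid (CyclotomicField 3 ℚ)

/-- The ring `ZZeta12` is indeed obtained from `ℤ` by adjoining a primitive twelfth root of
unity. -/
theorem isCyclotomicExtension_ZZeta12 : IsCyclotomicExtension {12} ℤ ZZeta12 := by
  have h3 : IsCyclotomicExtension {3} ℤ ZZeta3 :=
    IsCyclotomicExtension.ringOfIntegers
  obtain ⟨η, hη⟩ := h3.exists_isPrimitiveRoot (n := 3) rfl (by norm_num)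
  let f : ZZeta3 →ₐ[ℤ] ZZeta12 := (Algebra.ofId ZZeta3 ZZeta12).restrictScalars ℤ
  have hf : ∀ x, f x = ⟨x, 0⟩ := fun x => rfl
  have hfinj : Function.Injective f := fun x y h => by
    rw [hf, hf] at h
    exact congrArg QuadraticAlgebra.re h
  have hi2 : (⟨0, 1⟩ : ZZeta12) ^ 2 = -1 := by
    rw [sq]
    apply QuadraticAlgebra.ext <;> simp [QuadraticAlgebra.re_one, QuadraticAlgebra.im_one]
  have hi4 : (⟨0, 1⟩ : ZZeta12) ^ 4 = 1 := by
    rw [show (4 : ℕ) = 2 * 2 from rfl, pow_mul, hi2]; ring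
  have hne : (⟨0, 1⟩ : ZZeta12) ^ 2 ≠ 1 := by
    rw [hi2]
    intro h
    have h' := congrArg QuadraticAlgebra.re h
    simp only [QuadraticAlgebra.re_neg, QuadraticAlgebra.re_one] at h'
    have h2 : (2 : ZZeta3) = 0 := by linear_combination -h'
    exact two_ne_zero h2
  have ho4 : orderOf (⟨0, 1⟩ : ZZeta12) = 4 :=
    orderOf_eq_prime_pow (p := 2) (n := 1) (by simpa using hne) (by simpa using hi4)
  have hη' : IsPrimitiveRoot (f η) 3 := hη.map_of_injective hfinj
  have ho3 : orderOf (f η) = 3 := hη'.eq_orderOf.symm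
  refine ⟨?_, ?_⟩
  · rintro n rfl -
    refine ⟨⟨0, 1⟩ * f η, ?_⟩
    have := (Commute.all (⟨0, 1⟩ : ZZeta12) (f η)).orderOf_mul_eq_mul_orderOf_of_coprime
      (by rw [ho4, ho3]; decide)
    rw [ho4, ho3] at this
    exact IsPrimitiveRoot.iff_orderOf.2 this
  · intro x
    have key : ∀ y : ZZeta3, f y ∈ Algebra.adjoin ℤ
        {b : ZZeta12 | ∃ n : ℕ, n ∈ ({12} : Set ℕ) ∧ n ≠ 0 ∧ b ^ n = 1} := by
      intro y
      have hy := h3.adjoin_roots y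
      have : f y ∈ (Algebra.adjoin ℤ
          {b : ZZeta3 | ∃ n : ℕ, n ∈ ({3} : Set ℕ) ∧ n ≠ 0 ∧ b ^ n = 1}).map f := ⟨y, hy, rfl⟩
      rw [← Algebra.adjoin_image] at this
      refine Algebra.adjoin_mono ?_ this
      rintro _ ⟨b, ⟨n, rfl, -, hb⟩, rfl⟩
      refine ⟨12, rfl, by norm_num, ?_⟩
      rw [← map_pow, show (12 : ℕ) = 3 * 4 from rfl, pow_mul, hb, one_pow, map_one]
    have hi : (⟨0, 1⟩ : ZZeta12) ∈ Algebra.adjoin ℤ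
        {b : ZZeta12 | ∃ n : ℕ, n ∈ ({12} : Set ℕ) ∧ n ≠ 0 ∧ b ^ n = 1} := by
      refine Algebra.subset_adjoin ⟨12, rfl, by norm_num, ?_⟩
      rw [show (12 : ℕ) = 4 * 3 from rfl, pow_mul, hi4, one_pow]
    have hx : x = f x.re + ⟨0, 1⟩ * f x.im := by
      rw [hf, hf]
      apply QuadraticAlgebra.ext <;> simp
    rw [hx]
    exact add_mem (key _) (mul_mem hi (key _))

/-- `a` is primary: `a ≡ ± 1 (mod 3)`. (Used for `ℤ[ζ₃]` and for `ℤ[ζ₁₂]`.) -/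
def IsPrimary {R : Type*} [CommRing R] (a : R) : Prop :=
  (3 : R) ∣ a - 1 ∨ (3 : R) ∣ a + 1

/-- `w = u + i v` is primitive: `(u, v) = 1` in `ℤ[ζ₃]`. -/
def IsPrimitive (w : ZZeta12) : Prop := IsCoprime w.re w.im

/-- `N₃(a) = |a| ^ 2`, the norm of `ℚ(ζ₃) / ℚ`, as a natural number. -/
noncomputable def norm3 (a : ZZeta3) : ℕ := (Algebra.norm ℤ a).natAbs

/-- `N₁₂/₃(r + i s) = r ^ 2 + s ^ 2`. -/
noncomputable def relNorm (w : ZZeta12) : ZZeta3 := w.re ^ 2 + w.im ^ 2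

/-- `ξ` is a cube root of unity with `a ^ ((N π - 1) / 3) ≡ ξ (mod π)`. -/
def IsResidueRoot (a π ξ : ZZeta3) : Prop :=
  ξ ^ 3 = 1 ∧ π ∣ a ^ ((norm3 π - 1) / 3) - ξ

/-- For a prime `π` dividing neither `3` nor `a` there is exactly one such cube root of unity. -/
theorem existsUnique_isResidueRoot {a π : ZZeta3} (hπ : Prime π) (h3 : ¬ π ∣ 3) (ha : ¬ π ∣ a) :
    ∃! ξ, IsResidueRoot a π ξ := by
  have hcyc : IsCyclotomicExtension {3} ℤ ZZeta3 :=
    IsCyclotomicExtension.ringOfIntegers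
  obtain ⟨η, hη⟩ := hcyc.exists_isPrimitiveRoot (n := 3) rfl (by norm_num)
  have hη3 : η ^ 3 = 1 := hη.pow_eq_one
  have hηs : 1 + η + η ^ 2 = 0 := by
    have := hη.geom_sum_eq_zero (by norm_num)
    simpa [Finset.sum_range_succ] using this
  have hunit : ∀ ξ : ZZeta3, ξ ^ 3 = 1 → ¬ π ∣ ξ := fun ξ hξ hd => hπ.not_isUnit
    (isUnit_of_dvd_one (hξ ▸ hd.trans (dvd_pow_self ξ (by norm_num))))
  let I : Ideal ZZeta3 := Ideal.span {π}
  have hIprime : I.IsPrime := (Ideal.span_singleton_prime hπ.ne_zero).2 hπ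
  have hI0 : I ≠ ⊥ := by simpa [I] using hπ.ne_zero
  have hImax : I.IsMaximal := hIprime.isMaximal hI0
  let _ : Field (ZZeta3 ⧸ I) := Ideal.Quotient.field I
  have hfin : Finite (ZZeta3 ⧸ I) := Ideal.finiteQuotientOfFreeOfNeBot I hI0
  let _ : Fintype (ZZeta3 ⧸ I) := Fintype.ofFinite _
  have hcard : Fintype.card (ZZeta3 ⧸ I) = norm3 π := by
    rw [norm3, ← Ideal.absNorm_span_singleton, Ideal.absNorm_apply, Submodule.cardQuot_apply,
      Nat.card_eq_fintype_card]
  have hmk : ∀ x : ZZeta3, Ideal.Quotient.mk I x = 0 ↔ π ∣ x := fun x => by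
    rw [Ideal.Quotient.eq_zero_iff_mem, Ideal.mem_span_singleton]
  have hpow : ∀ x : ZZeta3, ¬ π ∣ x → Ideal.Quotient.mk I x ^ (norm3 π - 1) = 1 := fun x hx => by
    rw [← hcard]
    exact FiniteField.pow_card_sub_one_eq_one _ (fun h => hx ((hmk x).1 h))
  have hord : orderOf (Ideal.Quotient.mk I η) = 3 := by
    refine orderOf_eq_prime (by rw [← map_pow, hη3, map_one]) (fun h => h3 ?_)
    rw [← hmk]
    have := congrArg (Ideal.Quotient.mk I) hηs
    simp only [map_add, map_one, map_pow, h, map_zero] at this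
    rw [map_ofNat]
    linear_combination this
  have hdvd : 3 ∣ norm3 π - 1 := hord ▸ orderOf_dvd_of_pow_eq_one (hpow η (hunit η hη3))
  have hcube : π ∣ (a ^ ((norm3 π - 1) / 3)) ^ 3 - 1 := by
    rw [← hmk, ← pow_mul, Nat.div_mul_cancel hdvd, map_sub, map_pow, hpow a ha, map_one, sub_self]
  generalize hx : a ^ ((norm3 π - 1) / 3) = x at hcube
  have hfac : x ^ 3 - 1 = (x - 1) * ((x - η) * (x - η ^ 2)) := by
    linear_combination (x ^ 2 - x * η) * hηs + hη3
  refine existsUnique_of_exists_of_unique ?_ ?_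
  · rw [hfac] at hcube
    unfold IsResidueRoot
    rw [hx]
    rcases hπ.dvd_or_dvd hcube with h | h
    · exact ⟨1, one_pow 3, h⟩
    · rcases hπ.dvd_or_dvd h with h | h
      · exact ⟨η, hη3, h⟩
      · exact ⟨η ^ 2, by rw [← pow_mul, mul_comm, pow_mul, hη3, one_pow], h⟩
  · rintro ξ ξ' ⟨h1, h2⟩ ⟨h1', h2'⟩
    by_contra hne
    have hd : π ∣ ξ' - ξ := by
      have := dvd_sub h2 h2'
      rwa [sub_sub_sub_cancel_left] at this
    have hz : ξ ^ 2 + ξ * ξ' + ξ' ^ 2 = 0 := by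
      have hm : (ξ - ξ') * (ξ ^ 2 + ξ * ξ' + ξ' ^ 2) = 0 := by linear_combination h1 - h1'
      exact (mul_eq_zero.1 hm).resolve_left (sub_ne_zero.2 hne)
    have h3ξ : π ∣ 3 * ξ ^ 2 := by
      have : 3 * ξ ^ 2 = (ξ' - ξ) * (-(2 * ξ + ξ')) := by linear_combination hz
      rw [this]
      exact hd.mul_right _
    rcases hπ.dvd_or_dvd h3ξ with h | h
    · exact h3 h
    · exact hunit ξ h1 (hπ.dvd_of_dvd_pow h)

open scoped Classical in
/-- The cubic residue character `[a / π]₃` modulo a prime `π` of `ℤ[ζ₃]`, with values in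
`{0, 1, ζ₃, ζ₃ ^ 2} ⊆ ℤ[ζ₃]`. It is `1` by convention when `π` is the prime above `3`. (The last
`else` branch never occurs for a prime `π`.) -/
noncomputable def primeSymbol (a π : ZZeta3) : ZZeta3 :=
  if π ∣ 3 then 1
  else if π ∣ a then 0
  else if h : ∃ ξ, IsResidueRoot a π ξ then h.choose
  else 0

/-- The cubic residue character `[a / l]₃` for a nonzero `l : ℤ[ζ₃]`, extended multiplicatively
from the primes: the product of `[a / π]₃` over the prime factors `π` of `l`, with multiplicity.
In particular it is `1` when `l` is a unit. -/
noncomputable def cubicSymbol (a l : ZZeta3) : ZZeta3 :=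
  ((UniqueFactorizationMonoid.factors l).map (primeSymbol a)).prod

/-- The cubic spin `[r + i s] = [s / r]₃`. -/
noncomputable def spin (z : ZZeta12) : ZZeta3 := cubicSymbol z.im z.re

/-- `ω ≡ -v u⁻¹ (mod u ^ 2 + v ^ 2)`, where `w = u + i v`. -/
def IsOmega (w : ZZeta12) (ω : ZZeta3) : Prop :=
  ∃ u' : ZZeta3, relNorm w ∣ w.re * u' - 1 ∧ relNorm w ∣ ω - (-w.im * u')

theorem exists_isOmega {w : ZZeta12} (hw : IsPrimitive w) : ∃ ω, IsOmega w ω := by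
  have h : IsCoprime w.re (relNorm w) := by
    rw [relNorm, add_comm, sq w.re]
    exact (IsCoprime.add_mul_left_right_iff).2 hw.pow_right
  obtain ⟨p, q, hpq⟩ := h
  exact ⟨-w.im * p, p, ⟨-q, by linear_combination hpq⟩, by simp⟩

open scoped Classical in
/-- The symbol `(z / w) = [(r + ω s) / (u ^ 2 + v ^ 2)]₃` for primitive `w = u + i v`, where
`z = r + i s` and `ω ≡ -v u⁻¹ (mod u ^ 2 + v ^ 2)`. -/
noncomputable def twistSymbol (z w : ZZeta12) : ZZeta3 :=
  if h : ∃ ω, IsOmega w ω then cubicSymbol (z.re + h.choose * z.im) (relNorm w) else 0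

/-- `[a / l]₃` depends only on `a` modulo `l`. -/
theorem cubicSymbol_congr {a b l : ZZeta3} (h : l ∣ a - b) :
    cubicSymbol a l = cubicSymbol b l := by
  refine congrArg Multiset.prod (Multiset.map_congr rfl fun π hπ => ?_)
  have hd : π ∣ a - b := (UniqueFactorizationMonoid.dvd_of_mem_factors hπ).trans h
  have hab : π ∣ a ↔ π ∣ b := by
    refine ⟨fun h' => ?_, fun h' => ?_⟩
    · simpa using dvd_sub h' hd
    · simpa using dvd_add h' hd
  have hroot : IsResidueRoot a π = IsResidueRoot b π := by
    funext ξ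
    refine propext (and_congr_right fun _ => ?_)
    have hp : π ∣ a ^ ((norm3 π - 1) / 3) - b ^ ((norm3 π - 1) / 3) :=
      hd.trans (sub_dvd_pow_sub_pow a b _)
    refine ⟨fun h' => ?_, fun h' => ?_⟩
    · simpa using dvd_sub h' hp
    · simpa using dvd_add h' hp
  unfold primeSymbol
  rw [hroot]
  classical
  exact if_congr Iff.rfl rfl (if_congr hab rfl rfl)

/-- The symbol `(z / w)` does not depend on the choice of `ω`. -/
theorem twistSymbol_eq {w : ZZeta12} {ω : ZZeta3} (hω : IsOmega w ω)
    (z : ZZeta12) : twistSymbol z w = cubicSymbol (z.re + ω * z.im) (relNorm w) := by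
  have h : ∃ ω, IsOmega w ω := ⟨ω, hω⟩
  rw [twistSymbol, dif_pos h]
  apply cubicSymbol_congr
  obtain ⟨p, hp, hp'⟩ := h.choose_spec
  obtain ⟨q, hq, hq'⟩ := hω
  have hpq : relNorm w ∣ p - q := by
    have e : p - q = p * -(w.re * q - 1) + q * (w.re * p - 1) := by ring
    rw [e]
    exact dvd_add ((dvd_neg.2 hq).mul_left p) (hp.mul_left q)
  have e : z.re + h.choose * z.im - (z.re + ω * z.im) =
      ((h.choose - -w.im * p) - (ω - -w.im * q) - w.im * (p - q)) * z.im := by ring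
  rw [e]
  exact (dvd_sub (dvd_sub hp' hq') (hpq.mul_left _)).mul_right _

end CubicSpin

namespace CubicSpin

open NumberField

/-! Write w = u + iv, z = r + is and n = u² + v²; here u, r are primary and 3 divides v, s. The spin
of wz is the symbol of us + vr modulo ur − vs. Split off a primary gcd d of u and s: u = da, s = db,
ur − vs = dR with R = ar − vb primary. Modulo d the numerator is vr. Modulo R one has a(us + vr) ≡
bn, so the symbols [a/R], [n/R], [b/R] are needed. Cubic reciprocity (`IsPrimary.cubicSymbol_comm`)
turns the first two around, and ur − vs ≡ u(r + ωs) mod n produces the twist. As 3 ∣ b, reciprocity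
does not apply to b; instead [b/R] = [b/(ar)] because R ≡ ar modulo b and modulo 9
(`cubicSymbol_right_congr`). Only symbols of coprime pairs are cancelled, so the formula also holds
when its sides vanish (`cubicSymbol_mul_formula`). The symmetry of the twist follows from wz = zw,
since primitive elements have nonzero spin.

Reciprocity comes from Gauss sums: the cube of the Gauss sum modulo a primary prime π is ±π·Nπ, and
Frobenius at π' compares it with [Nπ'/π]. Conjugate primes escape this argument and are treated in
`cubicSymbol_conj_self`. -/

/-! ### The Eisenstein integers -/

/-- The cube root of unity `ζ₃` of `ℤ[ζ₃]`. -/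
noncomputable def eta : ZZeta3 :=
  (IsCyclotomicExtension.zeta_spec 3 ℚ (CyclotomicField 3 ℚ)).toInteger

theorem isPrimitiveRoot_eta : IsPrimitiveRoot eta 3 :=
  (IsCyclotomicExtension.zeta_spec 3 ℚ (CyclotomicField 3 ℚ)).toInteger_isPrimitiveRoot

theorem eta_pow_three : eta ^ 3 = 1 := isPrimitiveRoot_eta.pow_eq_one

theorem one_add_eta_add_sq : 1 + eta + eta ^ 2 = 0 := by
  simpa [Finset.sum_range_succ] using isPrimitiveRoot_eta.geom_sum_eq_zero (by norm_num)

theorem exists_eq_add_mul_eta (x : ZZeta3) : ∃ a b : ℤ, x = a + b * eta := by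
  obtain ⟨f, hf, rfl⟩ := PowerBasis.exists_eq_aeval
    (IsCyclotomicExtension.zeta_spec 3 ℚ (CyclotomicField 3 ℚ)).integralPowerBasis x
  rw [IsPrimitiveRoot.integralPowerBasis_dim, show Nat.totient 3 = 2 from rfl] at hf
  refine ⟨f.coeff 0, f.coeff 1, ?_⟩
  rw [IsPrimitiveRoot.integralPowerBasis_gen, Polynomial.aeval_eq_sum_range' hf]
  simp [Finset.sum_range_succ, eta]

theorem exists_conj : ∃ σ : ZZeta3 ≃+* ZZeta3, σ eta = eta ^ 2 ∧
    ∀ x : ZZeta3, ((Algebra.norm ℤ x : ℤ) : ZZeta3) = x * σ x := by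
  let hζ := IsCyclotomicExtension.zeta_spec 3 ℚ (CyclotomicField 3 ℚ)
  classical
  let e := IsCyclotomicExtension.Rat.galEquivZMod 3 (CyclotomicField 3 ℚ)
  let σ := e.symm (-1)
  have hσ : σ (IsCyclotomicExtension.zeta 3 ℚ (CyclotomicField 3 ℚ)) =
      IsCyclotomicExtension.zeta 3 ℚ (CyclotomicField 3 ℚ) ^ 2 := by
    rw [IsCyclotomicExtension.Rat.galEquivZMod_apply_of_pow_eq 3 _ σ hζ.pow_eq_one]
    have : IsCyclotomicExtension.Rat.galEquivZMod 3 (CyclotomicField 3 ℚ) σ = -1 :=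
      e.apply_symm_apply _
    -- The exponent is the representative 2 of −1 in `ZMod 3`.
    rw [this]
    rfl
  have hne : (1 : CyclotomicField 3 ℚ ≃ₐ[ℚ] CyclotomicField 3 ℚ) ≠ σ := by
    intro h
    have h1 : e 1 = -1 := by rw [h]; exact e.apply_symm_apply _
    rw [map_one] at h1
    exact absurd h1 (by decide)
  have : IsGalois ℚ (CyclotomicField 3 ℚ) := IsCyclotomicExtension.isGalois {3} ℚ _
  refine ⟨RingOfIntegers.mapRingEquiv σ.toRingEquiv, ?_, fun x => ?_⟩
  · apply RingOfIntegers.ext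
    exact hσ
  · apply RingOfIntegers.ext
    have h1 := Algebra.norm_eq_prod_automorphisms ℚ (x : CyclotomicField 3 ℚ)
    have huniv : (Finset.univ : Finset (CyclotomicField 3 ℚ ≃ₐ[ℚ] CyclotomicField 3 ℚ)) = {1, σ} := by
      symm
      apply Finset.eq_univ_of_card
      rw [Finset.card_pair hne, Fintype.card_congr e.toEquiv, ZMod.card_units_eq_totient]
      rfl
    rw [huniv, Finset.prod_pair hne, ← Algebra.coe_norm_int] at h1
    simpa using h1

/-- The nontrivial automorphism of `ℤ[ζ₃]`. -/
noncomputable def conj : ZZeta3 ≃+* ZZeta3 := exists_conj.choose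

theorem conj_eta : conj eta = eta ^ 2 := exists_conj.choose_spec.1

theorem conj_conj (x : ZZeta3) : conj (conj x) = x := by
  obtain ⟨a, b, rfl⟩ := exists_eq_add_mul_eta x
  simp only [map_add, map_mul, map_intCast, conj_eta, map_pow]
  linear_combination b * eta * eta_pow_three

/-- The norm form a² − ab + b² is nonnegative, so the absolute value in `norm3` changes nothing. -/
theorem norm3_eq (x : ZZeta3) : (norm3 x : ZZeta3) = x * conj x := by
  have h := exists_conj.choose_spec.2 x
  change _ = x * conj x at h
  obtain ⟨a, b, rfl⟩ := exists_eq_add_mul_eta x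
  have hn : Algebra.norm ℤ ((a : ZZeta3) + b * eta) = a ^ 2 - a * b + b ^ 2 := by
    have : ((Algebra.norm ℤ ((a : ZZeta3) + b * eta) : ℤ) : ZZeta3) =
        ((a ^ 2 - a * b + b ^ 2 : ℤ) : ZZeta3) := by
      rw [h]
      simp only [map_add, map_mul, map_intCast, conj_eta]
      push_cast
      linear_combination (a * b : ZZeta3) * one_add_eta_add_sq + (b ^ 2 : ZZeta3) * eta_pow_three
    exact_mod_cast this
  have h0 : 0 ≤ Algebra.norm ℤ ((a : ZZeta3) + b * eta) := by
    rw [hn]; nlinarith [sq_nonneg (a - b), sq_nonneg a, sq_nonneg b]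
  rw [← h, norm3]
  rw [← Int.cast_natCast, Int.natAbs_of_nonneg h0]

theorem norm3_mul (x y : ZZeta3) : norm3 (x * y) = norm3 x * norm3 y := by
  simp [norm3, Int.natAbs_mul]

theorem norm3_conj (x : ZZeta3) : norm3 (conj x) = norm3 x := by
  have : (norm3 (conj x) : ZZeta3) = norm3 x := by
    rw [norm3_eq, norm3_eq, conj_conj, mul_comm]
  exact_mod_cast this

theorem norm3_eq_of_associated {x y : ZZeta3} (h : Associated x y) : norm3 x = norm3 y := by
  rw [norm3, norm3, Int.natAbs_eq_iff_associated]
  exact h.map (Algebra.norm ℤ)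

theorem lambda_sq : (eta - 1) ^ 2 = -3 * eta := by
  linear_combination one_add_eta_add_sq

theorem isUnit_eta : IsUnit eta := IsUnit.of_pow_eq_one eta_pow_three (by norm_num)

theorem prime_lambda : Prime (eta - 1) :=
  (IsCyclotomicExtension.zeta_spec 3 ℚ (CyclotomicField 3 ℚ)).zeta_sub_one_prime'

theorem dvd_three_iff {π : ZZeta3} (hπ : Prime π) : π ∣ 3 ↔ Associated π (eta - 1) := by
  have h3 : Associated (3 : ZZeta3) ((eta - 1) ^ 2) := by
    obtain ⟨u, hu⟩ := isUnit_eta.neg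
    exact ⟨u, by rw [hu, lambda_sq]; ring⟩
  rw [h3.dvd_iff_dvd_right]
  refine ⟨fun h => ?_, fun h => h.dvd.trans (dvd_pow_self _ two_ne_zero)⟩
  exact hπ.associated_of_dvd prime_lambda (hπ.dvd_of_dvd_pow h)

/-- As η ≡ 1 modulo η − 1, the hypothesis says that a + b is nonzero mod 3. The residues of a, b mod
3 then decide which of 1, η, η² removes the η-coordinate mod 3. -/
theorem exists_unit_mul_isPrimary {x : ZZeta3} (hx : ¬ (eta - 1) ∣ x) :
    ∃ u : ZZeta3, IsUnit u ∧ IsPrimary (u * x) := by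
  obtain ⟨a, b, rfl⟩ := exists_eq_add_mul_eta x
  have hab : ¬ 3 ∣ a + b := by
    rintro ⟨c, hc⟩
    apply hx
    -- Here a + bη = 3c + b(η − 1), and 3 = −η²(η − 1)².
    refine ⟨b - c * eta ^ 2 * (eta - 1), ?_⟩
    have : (a : ZZeta3) = 3 * c - b := by
      rw [eq_sub_iff_add_eq]; exact_mod_cast hc
    rw [this]
    linear_combination (c * eta ^ 2 : ZZeta3) * lambda_sq - (3 * c : ZZeta3) * eta_pow_three
  have key : ∀ m n : ℤ, 3 ∣ n → ¬ 3 ∣ m → IsPrimary ((m : ZZeta3) + n * eta) := by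
    intro m n hn hm
    have : 3 ∣ m - 1 ∨ 3 ∣ m + 1 := by omega
    obtain ⟨d, rfl⟩ := hn
    rcases this with ⟨c, hc⟩ | ⟨c, hc⟩
    · exact .inl ⟨c + d * eta, by rw [eq_add_of_sub_eq hc]; push_cast; ring⟩
    · exact .inr ⟨c + d * eta, by rw [eq_sub_of_add_eq hc]; push_cast; ring⟩
  have : 3 ∣ b ∨ 3 ∣ a ∨ 3 ∣ a - b := by
    have ha : a % 3 = 0 ∨ a % 3 = 1 ∨ a % 3 = 2 := by omega
    have hb : b % 3 = 0 ∨ b % 3 = 1 ∨ b % 3 = 2 := by omega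
    rcases ha with ha | ha | ha <;> rcases hb with hb | hb | hb <;> omega
  rcases this with h | h | h
  · exact ⟨1, isUnit_one, by rw [one_mul]; exact key _ _ h (by omega)⟩
  · refine ⟨eta ^ 2, isUnit_eta.pow 2, ?_⟩
    convert key (b - a) (-a) (by omega) (by omega) using 1
    push_cast
    linear_combination (b : ZZeta3) * eta_pow_three + (a : ZZeta3) * one_add_eta_add_sq
  · refine ⟨eta, isUnit_eta, ?_⟩
    convert key (-b) (a - b) (by omega) (by omega) using 1
    push_cast
    linear_combination (b : ZZeta3) * one_add_eta_add_sq

theorem IsPrimary.not_lambda_dvd {x : ZZeta3} (hx : IsPrimary x) : ¬ (eta - 1) ∣ x := by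
  intro h
  have h3 : (eta - 1) ∣ 3 := (dvd_three_iff prime_lambda).2 (Associated.refl _)
  apply prime_lambda.not_isUnit
  apply isUnit_of_dvd_one
  rcases hx with hx | hx
  · simpa using dvd_sub h (h3.trans hx)
  · simpa using dvd_sub (h3.trans hx) h

theorem IsPrimary.ne_zero {x : ZZeta3} (hx : IsPrimary x) : x ≠ 0 := by
  rintro rfl
  exact hx.not_lambda_dvd (dvd_zero _)

theorem IsPrimary.not_dvd_three {x π : ZZeta3} (hx : IsPrimary x) (hπ : Prime π) (h : π ∣ x) :
    ¬ π ∣ 3 := fun h3 =>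
  hx.not_lambda_dvd (((dvd_three_iff hπ).1 h3).symm.dvd.trans h)

theorem IsPrimary.neg {R : Type*} [CommRing R] {x : R} (hx : IsPrimary x) : IsPrimary (-x) := by
  rcases hx with h | h
  · right; rw [← dvd_neg]; convert h using 1; ring
  · left; rw [← dvd_neg]; convert h using 1; ring

theorem IsPrimary.mul {R : Type*} [CommRing R] {x y : R} (hx : IsPrimary x) (hy : IsPrimary y) :
    IsPrimary (x * y) := by
  rcases hx with ⟨a, ha⟩ | ⟨a, ha⟩ <;> rcases hy with ⟨b, hb⟩ | ⟨b, hb⟩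
  · exact .inl ⟨a * y + b, by linear_combination y * ha + hb⟩
  · exact .inr ⟨a * y + b, by linear_combination y * ha + hb⟩
  · exact .inr ⟨a * y - b, by linear_combination y * ha - hb⟩
  · exact .inl ⟨a * y - b, by linear_combination y * ha - hb⟩

theorem IsPrimary.of_dvd_sub {R : Type*} [CommRing R] {x y : R} (hx : IsPrimary x)
    (h : (3 : R) ∣ x - y) : IsPrimary y := by
  rcases hx with hx | hx
  · left; simpa using dvd_sub hx h
  · right; convert dvd_sub hx h using 1; ring

theorem IsPrimary.conj {x : ZZeta3} (hx : IsPrimary x) : IsPrimary (conj x) := by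
  rcases hx with ⟨a, ha⟩ | ⟨a, ha⟩
  · exact .inl ⟨CubicSpin.conj a, by
      have := congrArg CubicSpin.conj ha
      rwa [map_mul, map_ofNat, map_sub, map_one] at this⟩
  · exact .inr ⟨CubicSpin.conj a, by
      have := congrArg CubicSpin.conj ha
      rwa [map_mul, map_ofNat, map_add, map_one] at this⟩

/-- Up to a sign, the only primary unit is `1`. -/
theorem IsPrimary.eq_one_or_neg_one {u : ZZeta3} (hu : IsUnit u) (h : IsPrimary u) :
    u = 1 ∨ u = -1 := by
  obtain ⟨u, rfl⟩ := hu
  have h3 : (eta - 1) ^ 2 ∣ 3 := ⟨-eta ^ 2, by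
    rw [lambda_sq]; linear_combination -3 * eta_pow_three⟩
  have := IsCyclotomicExtension.Rat.Three.eq_one_or_neg_one_of_unit_of_congruent
    (IsCyclotomicExtension.zeta_spec 3 ℚ (CyclotomicField 3 ℚ)) u (by
      rcases h with h | h
      · exact ⟨1, h3.trans (by simpa using h)⟩
      · exact ⟨-1, h3.trans (by simpa using h)⟩)
  exact this.imp (fun h => by rw [h, Units.val_one]) (fun h => by rw [h, Units.val_neg, Units.val_one])

/-! ### Primary elements and residue symbols -/

/-- Every prime factor of a primary element can be made primary by a unit. The unit left over is
then primary itself, hence ±1, which the `neg` case absorbs. -/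
theorem IsPrimary.induction {P : ZZeta3 → Prop} (one : P 1) (neg : ∀ x, P x → P (-x))
    (mul : ∀ p x, Prime p → IsPrimary p → IsPrimary x → P x → P (p * x))
    {x : ZZeta3} (hx : IsPrimary x) : P x := by
  have key : ∀ y : ZZeta3, ¬ (eta - 1) ∣ y →
      ∃ u : ZZeta3, IsUnit u ∧ IsPrimary (u * y) ∧ P (u * y) := by
    intro y
    induction y using UniqueFactorizationMonoid.induction_on_prime with
    | h₁ => exact fun h => absurd (dvd_zero _) h
    | h₂ y hy =>
      intro _
      obtain ⟨y, rfl⟩ := hy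
      exact ⟨_, (y⁻¹).isUnit, by simp [IsPrimary], by simpa using one⟩
    | h₃ y p _ hp ih =>
      intro h
      obtain ⟨u, hu, huy, hP⟩ := ih fun h' => h (h'.mul_left _)
      obtain ⟨v, hv, hvp⟩ := exists_unit_mul_isPrimary fun h' => h (h'.mul_right y)
      have hvp' : Prime (v * p) := (associated_unit_mul_right p v hv).prime hp
      refine ⟨v * u, hv.mul hu, ?_, ?_⟩
      · rw [mul_mul_mul_comm]; exact hvp.mul huy
      · rw [mul_mul_mul_comm]; exact mul _ _ hvp' hvp huy hP
  obtain ⟨u, hu, hux, hP⟩ := key x hx.not_lambda_dvd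
  have hu' : IsPrimary u := by
    rcases hx with h | h
    · refine hux.of_dvd_sub ?_
      convert h.mul_left u using 1; ring
    · refine (hux.neg).of_dvd_sub ?_
      rw [← dvd_neg]
      convert h.mul_left u using 1; ring
  rcases hu'.eq_one_or_neg_one hu with rfl | rfl
  · simpa using hP
  · simpa using neg _ hP

theorem norm3_intCast (n : ℤ) : (norm3 n : ℤ) = n ^ 2 := by
  have : ((norm3 n : ℤ) : ZZeta3) = ((n ^ 2 : ℤ) : ZZeta3) := by
    rw [Int.cast_natCast, norm3_eq, map_intCast]
    push_cast; ring
  exact_mod_cast this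

/-- Norms turn the divisibility into m² ∣ n² in ℤ. -/
theorem intCast_dvd_intCast {m n : ℤ} : (m : ZZeta3) ∣ n ↔ m ∣ n := by
  refine ⟨fun ⟨c, hc⟩ => ?_, fun h => by exact_mod_cast map_dvd (Int.castRingHom ZZeta3) h⟩
  rw [← Int.pow_dvd_pow_iff two_ne_zero, ← norm3_intCast, ← norm3_intCast, hc, norm3_mul]
  exact ⟨norm3 c, by push_cast; rfl⟩

theorem IsPrimary.three_dvd_norm3_sub_one {x : ZZeta3} (hx : IsPrimary x) :
    (3 : ℤ) ∣ norm3 x - 1 := by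
  rw [← intCast_dvd_intCast]
  push_cast
  rw [norm3_eq]
  rcases hx with ⟨a, ha⟩ | ⟨a, ha⟩
  · rw [eq_add_of_sub_eq ha]
    simp only [map_add, map_mul, map_one, map_ofNat]
    exact ⟨a + CubicSpin.conj a + 3 * a * CubicSpin.conj a, by ring⟩
  · rw [eq_sub_of_add_eq ha]
    simp only [map_sub, map_mul, map_one, map_ofNat]
    exact ⟨-a - CubicSpin.conj a + 3 * a * CubicSpin.conj a, by ring⟩

theorem three_dvd_norm3_sub_one {π : ZZeta3} (hπ : Prime π) (h3 : ¬ π ∣ 3) :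
    3 ∣ norm3 π - 1 := by
  obtain ⟨u, hu, hup⟩ := exists_unit_mul_isPrimary (x := π) fun h =>
    h3 ((dvd_three_iff hπ).2 (prime_lambda.associated_of_dvd hπ h).symm)
  have := hup.three_dvd_norm3_sub_one
  rw [norm3_eq_of_associated (associated_unit_mul_left π u hu)] at this
  omega

theorem natCard_quotient (π : ZZeta3) : Nat.card (ZZeta3 ⧸ Ideal.span {π}) = norm3 π := by
  rw [norm3, ← Ideal.absNorm_span_singleton, Ideal.absNorm_apply, Submodule.cardQuot_apply]

theorem one_lt_norm3 {π : ZZeta3} (hπ : Prime π) : 1 < norm3 π := by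
  have h0 : norm3 π ≠ 0 := by
    rw [norm3, Int.natAbs_ne_zero, Algebra.norm_ne_zero_iff]
    exact hπ.ne_zero
  have h1 : norm3 π ≠ 1 := fun h => hπ.not_isUnit (IsUnit.of_mul_eq_one (conj π) (by
    rw [← norm3_eq, h, Nat.cast_one]))
  omega

/-- Distinct cube roots of unity satisfy 3ξ² = (ξ − ξ')(2ξ + ξ'), so they stay distinct modulo π.
This lifts congruences between symbol values to equalities. -/
theorem eq_of_cube_eq_one_of_dvd_sub {π ξ ξ' : ZZeta3} (hπ : Prime π) (h3 : ¬ π ∣ 3)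
    (h : ξ ^ 3 = 1) (h' : ξ' ^ 3 = 1) (hd : π ∣ ξ - ξ') : ξ = ξ' := by
  by_contra hne
  have hz : ξ ^ 2 + ξ * ξ' + ξ' ^ 2 = 0 :=
    (mul_eq_zero.1 (show (ξ - ξ') * (ξ ^ 2 + ξ * ξ' + ξ' ^ 2) = 0 by
      linear_combination h - h')).resolve_left (sub_ne_zero.2 hne)
  have h3ξ : π ∣ 3 * ξ ^ 2 :=
    (show 3 * ξ ^ 2 = (ξ - ξ') * (2 * ξ + ξ') by linear_combination hz) ▸ hd.mul_right _
  rcases hπ.dvd_or_dvd h3ξ with h4 | h4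
  · exact h3 h4
  · exact hπ.not_isUnit (isUnit_of_dvd_one (h ▸ (hπ.dvd_of_dvd_pow h4).trans
      (dvd_pow_self ξ three_ne_zero)))

theorem primeSymbol_of_dvd_three {π : ZZeta3} (a : ZZeta3) (h3 : π ∣ 3) : primeSymbol a π = 1 :=
  if_pos h3

theorem primeSymbol_eq_zero {a π : ZZeta3} (h3 : ¬ π ∣ 3) (ha : π ∣ a) : primeSymbol a π = 0 := by
  rw [primeSymbol, if_neg h3, if_pos ha]

theorem isResidueRoot_primeSymbol {a π : ZZeta3} (hπ : Prime π) (h3 : ¬ π ∣ 3) (ha : ¬ π ∣ a) :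
    IsResidueRoot a π (primeSymbol a π) := by
  have h := (existsUnique_isResidueRoot hπ h3 ha).exists
  rw [primeSymbol, if_neg h3, if_neg ha, dif_pos h]
  exact h.choose_spec

theorem primeSymbol_eq {a π ξ : ZZeta3} (hπ : Prime π) (h3 : ¬ π ∣ 3) (ha : ¬ π ∣ a)
    (h : IsResidueRoot a π ξ) : primeSymbol a π = ξ :=
  (existsUnique_isResidueRoot hπ h3 ha).unique (isResidueRoot_primeSymbol hπ h3 ha) h

theorem primeSymbol_eq_zero_or {π : ZZeta3} (hπ : Prime π) (a : ZZeta3) :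
    primeSymbol a π = 0 ∨ primeSymbol a π ^ 3 = 1 := by
  by_cases h3 : π ∣ 3
  · rw [primeSymbol_of_dvd_three a h3]; simp
  by_cases ha : π ∣ a
  · exact .inl (primeSymbol_eq_zero h3 ha)
  · exact .inr (isResidueRoot_primeSymbol hπ h3 ha).1

theorem dvd_pow_sub_primeSymbol {π : ZZeta3} (hπ : Prime π) (h3 : ¬ π ∣ 3) (a : ZZeta3) :
    π ∣ a ^ ((norm3 π - 1) / 3) - primeSymbol a π := by
  by_cases ha : π ∣ a
  · rw [primeSymbol_eq_zero h3 ha, sub_zero]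
    have h1 := one_lt_norm3 hπ
    have h2 := three_dvd_norm3_sub_one hπ h3
    -- The exponent is positive because Nπ > 1 and Nπ ≡ 1 mod 3.
    exact ha.trans (dvd_pow_self a (by omega))
  · exact (isResidueRoot_primeSymbol hπ h3 ha).2

theorem primeSymbol_mul {π : ZZeta3} (hπ : Prime π) (a b : ZZeta3) :
    primeSymbol (a * b) π = primeSymbol a π * primeSymbol b π := by
  by_cases h3 : π ∣ 3
  · simp [primeSymbol_of_dvd_three _ h3]
  by_cases ha : π ∣ a
  · rw [primeSymbol_eq_zero h3 ha, primeSymbol_eq_zero h3 (ha.mul_right b), zero_mul]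
  by_cases hb : π ∣ b
  · rw [primeSymbol_eq_zero h3 hb, primeSymbol_eq_zero h3 (hb.mul_left a), mul_zero]
  refine primeSymbol_eq hπ h3 (fun h => (hπ.dvd_or_dvd h).elim ha hb) ⟨?_, ?_⟩
  · rw [mul_pow, (isResidueRoot_primeSymbol hπ h3 ha).1, (isResidueRoot_primeSymbol hπ h3 hb).1,
      one_mul]
  · obtain ⟨c, hc⟩ := dvd_pow_sub_primeSymbol hπ h3 a
    obtain ⟨d, hd⟩ := dvd_pow_sub_primeSymbol hπ h3 b
    rw [mul_pow]
    exact ⟨c * b ^ ((norm3 π - 1) / 3) + primeSymbol a π * d, by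
      linear_combination b ^ ((norm3 π - 1) / 3) * hc + primeSymbol a π * hd⟩

theorem primeSymbol_eq_of_associated {π π' : ZZeta3} (h : Associated π π') (a : ZZeta3) :
    primeSymbol a π = primeSymbol a π' := by
  have hroot : IsResidueRoot a π = IsResidueRoot a π' := by
    funext ξ
    rw [IsResidueRoot, IsResidueRoot, norm3_eq_of_associated h, h.dvd_iff_dvd_left]
  unfold primeSymbol
  rw [hroot]
  classical
  exact if_congr h.dvd_iff_dvd_left rfl (if_congr h.dvd_iff_dvd_left rfl rfl)

theorem prime_conj {π : ZZeta3} (hπ : Prime π) : Prime (conj π) :=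
  (MulEquiv.prime_iff conj).2 hπ

theorem conj_dvd_conj {a b : ZZeta3} : conj a ∣ conj b ↔ a ∣ b := map_dvd_iff conj

theorem primeSymbol_conj {π : ZZeta3} (hπ : Prime π) (a : ZZeta3) :
    primeSymbol (conj a) (conj π) = conj (primeSymbol a π) := by
  have h3' : conj π ∣ 3 ↔ π ∣ 3 := by
    have := conj_dvd_conj (a := π) (b := 3)
    rwa [map_ofNat] at this
  by_cases h3 : π ∣ 3
  · simp [primeSymbol_of_dvd_three _ h3, primeSymbol_of_dvd_three _ (h3'.2 h3)]
  rw [← h3'] at h3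
  by_cases ha : π ∣ a
  · rw [primeSymbol_eq_zero h3 (conj_dvd_conj.2 ha), primeSymbol_eq_zero (h3 ∘ h3'.2) ha, map_zero]
  refine primeSymbol_eq (prime_conj hπ) h3 (mt conj_dvd_conj.1 ha) ⟨?_, ?_⟩
  · rw [← map_pow, (isResidueRoot_primeSymbol hπ (h3 ∘ h3'.2) ha).1, map_one]
  · rw [norm3_conj, ← map_pow, ← map_sub, conj_dvd_conj]
    exact dvd_pow_sub_primeSymbol hπ (h3 ∘ h3'.2) a

/-! ### The symbol for composite moduli -/

section CompositeModuli

open UniqueFactorizationMonoid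

theorem cubicSymbol_mul_left (a b l : ZZeta3) :
    cubicSymbol (a * b) l = cubicSymbol a l * cubicSymbol b l := by
  rw [cubicSymbol, cubicSymbol, cubicSymbol, ← Multiset.prod_map_mul]
  exact congrArg _ (Multiset.map_congr rfl fun π hπ => primeSymbol_mul (prime_of_factor π hπ) a b)

theorem prod_primeSymbol_eq_of_rel (a : ZZeta3) {s t : Multiset ZZeta3}
    (h : Multiset.Rel Associated s t) :
    (s.map (primeSymbol a)).prod = (t.map (primeSymbol a)).prod := by
  have : s.map (primeSymbol a) = t.map (primeSymbol a) := Multiset.rel_eq.1 <|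
    Multiset.rel_map.2 (h.mono fun x _ y _ hxy => primeSymbol_eq_of_associated hxy a)
  rw [this]

theorem cubicSymbol_mul_right (a : ZZeta3) {l m : ZZeta3} (hl : l ≠ 0) (hm : m ≠ 0) :
    cubicSymbol a (l * m) = cubicSymbol a l * cubicSymbol a m := by
  have h := prod_primeSymbol_eq_of_rel a (factors_mul hl hm)
  rwa [Multiset.map_add, Multiset.prod_add] at h

theorem cubicSymbol_of_isUnit (a : ZZeta3) {u : ZZeta3} (hu : IsUnit u) : cubicSymbol a u = 1 := by
  rw [cubicSymbol, factors_of_isUnit hu]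
  rfl

theorem cubicSymbol_neg_right (a l : ZZeta3) : cubicSymbol a (-l) = cubicSymbol a l := by
  rcases eq_or_ne l 0 with rfl | hl
  · rw [neg_zero]
  · rw [neg_eq_neg_one_mul, cubicSymbol_mul_right a (by simp) hl,
      cubicSymbol_of_isUnit a isUnit_one.neg, one_mul]

theorem cubicSymbol_prime (a : ZZeta3) {π : ZZeta3} (hπ : Prime π) :
    cubicSymbol a π = primeSymbol a π := by
  obtain ⟨p, hp, h⟩ := factors_eq_singleton_of_irreducible hπ.irreducible
  rw [cubicSymbol, h, Multiset.map_singleton, Multiset.prod_singleton,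
    primeSymbol_eq_of_associated hp]

theorem cubicSymbol_eq_zero_or (a l : ZZeta3) :
    cubicSymbol a l = 0 ∨ cubicSymbol a l ^ 3 = 1 := by
  rw [cubicSymbol]
  have h : ∀ π ∈ factors l, Prime π := prime_of_factor
  generalize factors l = s at h
  induction s using Multiset.induction with
  | empty => simp
  | cons π s ih =>
    rw [Multiset.map_cons, Multiset.prod_cons]
    rcases primeSymbol_eq_zero_or (h π (Multiset.mem_cons_self _ _)) a with h1 | h1
    · simp [h1]
    rcases ih fun ρ hρ => h ρ (Multiset.mem_cons_of_mem hρ) with h2 | h2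
    · simp [h2]
    · right; rw [mul_pow, h1, h2, one_mul]

theorem cubicSymbol_ne_zero {a l : ZZeta3} (h : IsCoprime a l) : cubicSymbol a l ≠ 0 := by
  rw [cubicSymbol, Ne, Multiset.prod_eq_zero_iff, Multiset.mem_map]
  rintro ⟨π, hπ, h0⟩
  have hp := prime_of_factor π hπ
  by_cases h3 : π ∣ 3
  · rw [primeSymbol_of_dvd_three a h3] at h0
    exact one_ne_zero h0
  have ha : ¬ π ∣ a := fun ha => hp.not_isUnit (h.isUnit_of_dvd' ha (dvd_of_mem_factors hπ))
  have := (isResidueRoot_primeSymbol hp h3 ha).1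
  simp [h0] at this

theorem cubicSymbol_pow_three {a l : ZZeta3} (h : IsCoprime a l) : cubicSymbol a l ^ 3 = 1 :=
  (cubicSymbol_eq_zero_or a l).resolve_left (cubicSymbol_ne_zero h)

/-- The value is idempotent and nonzero. -/
theorem cubicSymbol_one_left (l : ZZeta3) : cubicSymbol 1 l = 1 := by
  have h := cubicSymbol_mul_left 1 1 l
  rw [mul_one] at h
  exact (mul_eq_left₀ (cubicSymbol_ne_zero isCoprime_one_left)).1 h.symm

theorem cubicSymbol_pow_left (a l : ZZeta3) (n : ℕ) :
    cubicSymbol (a ^ n) l = cubicSymbol a l ^ n := by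
  induction n with
  | zero => simp [cubicSymbol_one_left]
  | succ n ih => rw [pow_succ, pow_succ, cubicSymbol_mul_left, ih]

/-- −1 is a cube. -/
theorem cubicSymbol_neg_left (a l : ZZeta3) : cubicSymbol (-a) l = cubicSymbol a l := by
  have h1 : cubicSymbol (-1) l ^ 3 = 1 := cubicSymbol_pow_three isCoprime_one_left.neg_left
  have h2 : cubicSymbol ((-1) ^ 3) l = cubicSymbol (-1) l ^ 3 := cubicSymbol_pow_left _ _ _
  rw [neg_eq_neg_one_mul, cubicSymbol_mul_left, show (-1 : ZZeta3) = (-1) ^ 3 by norm_num, h2, h1,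
    one_mul]

theorem cubicSymbol_conj (a l : ZZeta3) :
    cubicSymbol (conj a) (conj l) = conj (cubicSymbol a l) := by
  induction l using induction_on_prime with
  -- `factors 0` is empty, so both symbols take the default value 1.
  | h₁ => simp [cubicSymbol]
  | h₂ l hl => rw [cubicSymbol_of_isUnit _ hl, cubicSymbol_of_isUnit _ (hl.map conj), map_one]
  | h₃ l p hl hp ih =>
    rw [map_mul, cubicSymbol_mul_right _ (by simpa using hp.ne_zero) (by simpa using hl),
      cubicSymbol_mul_right _ hp.ne_zero hl, ih, map_mul, cubicSymbol_prime _ hp,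
      cubicSymbol_prime _ (prime_conj hp), primeSymbol_conj hp]

end CompositeModuli

/-! ### Gauss sums of cubic residue characters -/

theorem gaussSum_pow_char_pow {R R' : Type*} [CommRing R] [Fintype R] [CommRing R'] (p : ℕ)
    [Fact p.Prime] [CharP R' p] (χ : MulChar R R') (ψ : AddChar R R') (n : ℕ) :
    gaussSum χ ψ ^ p ^ n = gaussSum (χ ^ p ^ n) (ψ ^ p ^ n) := by
  induction n with
  | zero => simp
  | succ n ih => rw [pow_succ, pow_mul, ih, gaussSum_frob, ← pow_mul, ← pow_mul]

/-- Comparing the cube of the Gauss sum of a cubic character with its Frobenius conjugates. -/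
theorem cubic_gaussSum_relation {F F' : Type*} [Field F] [Fintype F] [Field F'] [Fintype F']
    {χ : MulChar F F'} (hχ : χ ≠ 1) (hχ3 : χ ^ 3 = 1) (hchar : ringChar F' ≠ ringChar F)
    (hcard : 3 ∣ Fintype.card F' - 1) :
    χ (Fintype.card F') *
      ((Fintype.card F : F') * jacobiSum χ χ) ^ ((Fintype.card F' - 1) / 3) = 1 := by
  obtain ⟨n, hp, hc⟩ := FiniteField.card F (ringChar F)
  obtain ⟨n', hp', hc'⟩ := FiniteField.card F' (ringChar F')
  let ψ := AddChar.FiniteField.primitiveChar F F' hchar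
  let FF := CyclotomicField ψ.n F'
  have hinj := (algebraMap F' FF).injective
  have hcharFF := Algebra.ringChar_eq F' FF
  let φ := χ.ringHomComp (algebraMap F' FF)
  have hφ : φ ≠ 1 := (MulChar.ringHomComp_ne_one_iff hinj).mpr hχ
  have hφ3 : φ ^ 3 = 1 := by
    rw [show φ = χ.ringHomComp (algebraMap F' FF) from rfl, MulChar.ringHomComp_pow, hχ3,
      MulChar.ringHomComp_one]
  have hord : orderOf φ = 3 := orderOf_eq_prime hφ3 hφ
  have hneg : φ (-1) = 1 := by
    have h2 : φ (-1) ^ 2 = 1 := by rw [← map_pow]; simp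
    have h3 : φ (-1) ^ 3 = 1 := by
      rw [← MulChar.pow_apply' _ three_ne_zero, hφ3, MulChar.one_apply isUnit_one.neg]
    calc φ (-1) = φ (-1) ^ 3 := by rw [pow_succ, h2, one_mul]
      _ = 1 := h3
  -- For a character of order 3 the product of Jacobi sums has a single factor.
  have hcube : gaussSum φ ψ.char ^ 3 = (Fintype.card F : FF) * jacobiSum φ φ := by
    have := gaussSum_pow_eq_prod_jacobiSum (χ := φ) (by omega) ψ.prim
    rw [hord, hneg] at this
    simpa using this
  have hFcard : (Fintype.card F : FF) ≠ 0 := by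
    intro H
    rw [hc, Nat.cast_pow, pow_eq_zero_iff n.ne_zero] at H
    exact hchar (hcharFF.trans (CharP.ringChar_of_prime_eq_zero hp H))
  have hg : gaussSum φ ψ.char ≠ 0 := gaussSum_ne_zero_of_nontrivial hFcard hφ ψ.prim
  have hunit : IsUnit (Fintype.card F' : F) := by
    rw [hc', Nat.cast_pow]
    refine IsUnit.pow _ (isUnit_iff_ne_zero.2 fun H => ?_)
    exact hchar (CharP.ringChar_of_prime_eq_zero hp' H).symm
  have := Fact.mk (hcharFF.subst hp')
  have hq : Fintype.card F' = 3 * ((Fintype.card F' - 1) / 3) + 1 := by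
    have : 0 < Fintype.card F' := Fintype.card_pos
    omega
  -- With q' = |F'|, the q'-th power is a power of Frobenius. It fixes φ because q' ≡ 1 mod 3, and
  -- multiplies the argument of ψ by q'.
  have hfrob : φ (Fintype.card F') * gaussSum φ ψ.char ^ Fintype.card F' = gaussSum φ ψ.char := by
    have hφq : φ ^ Fintype.card F' = φ := by
      rw [hq, pow_succ, pow_mul, hφ3, one_pow, one_mul]
    have h1 := gaussSum_pow_char_pow (ringChar FF) φ ψ.char n'
    rw [← hcharFF, ← hc', hφq, AddChar.pow_mulShift] at h1
    rw [h1, ← hunit.unit_spec, gaussSum_mulShift]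
  rw [hq, pow_succ, pow_mul, hcube, ← mul_assoc, mul_eq_right₀ hg, ← hq] at hfrob
  apply hinj
  rw [map_mul, map_pow, map_mul, map_natCast (algebraMap F' FF), ← jacobiSum_ringHomComp, map_one]
  exact hfrob

/-- Power sums over F of exponent below |F| − 1 vanish. With m = n = (Nπ − 1)/3 this shows that π
divides the Jacobi sum of the cubic character. -/
theorem sum_pow_mul_one_sub_pow {F : Type*} [Field F] [Fintype F] {m n : ℕ}
    (h : m + n < Fintype.card F - 1) : ∑ x : F, x ^ m * (1 - x) ^ n = 0 := by
  have h1 : ∀ x : F, x ^ m * (1 - x) ^ n =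
      ∑ k ∈ Finset.range (n + 1), ((-1) ^ k * (n.choose k : F)) * x ^ (m + k) := by
    intro x
    rw [show 1 - x = -x + 1 by ring, add_pow, Finset.mul_sum]
    refine Finset.sum_congr rfl fun k _ => ?_
    rw [neg_pow, one_pow, pow_add]; ring
  simp_rw [h1]
  rw [Finset.sum_comm]
  refine Finset.sum_eq_zero fun k hk => ?_
  rw [← Finset.mul_sum, FiniteField.sum_pow_lt_card_sub_one, mul_zero]
  rw [Finset.mem_range] at hk
  omega

/-! ### The residue symbol as a character of the residue field -/

theorem isMaximal_span {π : ZZeta3} (hπ : Prime π) : (Ideal.span {π}).IsMaximal :=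
  ((Ideal.span_singleton_prime hπ.ne_zero).2 hπ).isMaximal (by simpa using hπ.ne_zero)

theorem mk_eq_zero {π x : ZZeta3} : Ideal.Quotient.mk (Ideal.span {π}) x = 0 ↔ π ∣ x := by
  rw [Ideal.Quotient.eq_zero_iff_mem, Ideal.mem_span_singleton]

theorem primeSymbol_congr {a b π : ZZeta3} (hπ : Prime π) (h : π ∣ a - b) :
    primeSymbol a π = primeSymbol b π := by
  rw [← cubicSymbol_prime a hπ, ← cubicSymbol_prime b hπ, cubicSymbol_congr h]

/-- The cubic residue character as a multiplicative character of `ℤ[ζ₃] / π`. -/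
noncomputable def cubicChar {π : ZZeta3} (hπ : Prime π) (h3 : ¬ π ∣ 3) :
    MulChar (ZZeta3 ⧸ Ideal.span {π}) ZZeta3 where
  toFun x := primeSymbol x.out π
  map_one' := by
    rw [← cubicSymbol_one_left π, cubicSymbol_prime _ hπ]
    refine primeSymbol_congr hπ ?_
    rw [← mk_eq_zero, map_sub, sub_eq_zero, map_one]
    exact Quotient.out_eq _
  map_mul' x y := by
    rw [← primeSymbol_mul hπ]
    refine primeSymbol_congr hπ ?_
    rw [← mk_eq_zero, map_sub, sub_eq_zero, map_mul]
    exact (Quotient.out_eq _).trans (congrArg₂ _ (Quotient.out_eq x).symm (Quotient.out_eq y).symm)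
  map_nonunit' x hx := by
    have := isMaximal_span hπ
    let _ := Ideal.Quotient.field (Ideal.span {π})
    refine primeSymbol_eq_zero h3 ?_
    rw [← mk_eq_zero]
    rw [isUnit_iff_ne_zero, not_not] at hx
    exact (Quotient.out_eq x).trans hx

theorem cubicChar_mk {π : ZZeta3} (hπ : Prime π) (h3 : ¬ π ∣ 3) (a : ZZeta3) :
    cubicChar hπ h3 (Ideal.Quotient.mk _ a) = primeSymbol a π := by
  refine primeSymbol_congr hπ ?_
  rw [← mk_eq_zero, map_sub, sub_eq_zero]
  exact Quotient.out_eq _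

theorem mk_cubicChar {π : ZZeta3} (hπ : Prime π) (h3 : ¬ π ∣ 3) (x : ZZeta3 ⧸ Ideal.span {π}) :
    Ideal.Quotient.mk _ (cubicChar hπ h3 x) = x ^ ((norm3 π - 1) / 3) := by
  obtain ⟨a, rfl⟩ := Ideal.Quotient.mk_surjective x
  rw [cubicChar_mk, ← map_pow, ← sub_eq_zero, ← map_sub, mk_eq_zero, ← neg_sub, dvd_neg]
  exact dvd_pow_sub_primeSymbol hπ h3 a

theorem cubicChar_pow_three {π : ZZeta3} (hπ : Prime π) (h3 : ¬ π ∣ 3) :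
    cubicChar hπ h3 ^ 3 = 1 := by
  have := isMaximal_span hπ
  let _ := Ideal.Quotient.field (Ideal.span {π})
  refine MulChar.ext fun x => ?_
  obtain ⟨a, ha⟩ := Ideal.Quotient.mk_surjective (x : ZZeta3 ⧸ Ideal.span {π})
  rw [MulChar.pow_apply_coe, MulChar.one_apply_coe, ← ha, cubicChar_mk]
  refine (isResidueRoot_primeSymbol hπ h3 fun h => x.ne_zero ?_).1
  rw [← ha, mk_eq_zero.2 h]

/-- Otherwise (Nπ − 1)/3 would kill the unit group of the residue field, which is cyclic of order Nπ
− 1. -/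
theorem cubicChar_ne_one {π : ZZeta3} (hπ : Prime π) (h3 : ¬ π ∣ 3) :
    cubicChar hπ h3 ≠ 1 := by
  intro h
  have := isMaximal_span hπ
  let _ := Ideal.Quotient.field (Ideal.span {π})
  have hfin : Finite (ZZeta3 ⧸ Ideal.span {π}) :=
    Ideal.finiteQuotientOfFreeOfNeBot _ (by simpa using hπ.ne_zero)
  let _ := Fintype.ofFinite (ZZeta3 ⧸ Ideal.span {π})
  have h1 : ∀ x : (ZZeta3 ⧸ Ideal.span {π})ˣ, x ^ ((norm3 π - 1) / 3) = 1 := by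
    intro x
    apply Units.ext
    rw [Units.val_pow_eq_pow_val, ← mk_cubicChar hπ h3, h, MulChar.one_apply_coe, map_one,
      Units.val_one]
  rw [FiniteField.forall_pow_eq_one_iff, ← Nat.card_eq_fintype_card, natCard_quotient] at h1
  have h2 := one_lt_norm3 hπ
  have h4 := three_dvd_norm3_sub_one hπ h3
  have := Nat.le_of_dvd (by omega) h1
  omega

/-! ### Cubic reciprocity -/

/-- The Jacobi sum of the cubic residue character modulo a primary prime. -/
theorem jacobiSum_cubicChar {π : ZZeta3} (hπ : Prime π) (h3 : ¬ π ∣ 3) (hprim : IsPrimary π)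
    [Fintype (ZZeta3 ⧸ Ideal.span {π})] :
    jacobiSum (cubicChar hπ h3) (cubicChar hπ h3) = π ∨
      jacobiSum (cubicChar hπ h3) (cubicChar hπ h3) = -π := by
  have := isMaximal_span hπ
  let _ := Ideal.Quotient.field (Ideal.span {π})
  have hcard : Fintype.card (ZZeta3 ⧸ Ideal.span {π}) = norm3 π := by
    rw [← natCard_quotient, Nat.card_eq_fintype_card]
  have hN1 := one_lt_norm3 hπ
  have hN3 := three_dvd_norm3_sub_one hπ h3
  let χ := cubicChar hπ h3
  have hχ3 : χ ^ 3 = 1 := cubicChar_pow_three hπ h3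
  have hχ1 : χ ≠ 1 := cubicChar_ne_one hπ h3
  have hχinv : χ⁻¹ = χ ^ 2 := by
    rw [inv_eq_iff_mul_eq_one, ← pow_succ', hχ3]
  change jacobiSum χ χ = π ∨ jacobiSum χ χ = -π
  have hdvd : π ∣ jacobiSum χ χ := by
    rw [← mk_eq_zero, jacobiSum, map_sum]
    simp_rw [map_mul]
    have : ∀ x, Ideal.Quotient.mk (Ideal.span {π}) (χ x) = x ^ ((norm3 π - 1) / 3) :=
      mk_cubicChar hπ h3
    simp_rw [this]
    apply sum_pow_mul_one_sub_pow
    omega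
  -- The Jacobi sum is −1 modulo (η − 1)² = −3η.
  have hprimJ : (3 : ZZeta3) ∣ jacobiSum χ χ + 1 := by
    obtain ⟨z, -, hz⟩ := exists_jacobiSum_eq_neg_one_add (by norm_num : 2 < 3) hχ3 hχ3
      (by rwa [hcard]) isPrimitiveRoot_eta
    rw [hz, lambda_sq]
    exact ⟨-z * eta, by ring⟩
  have hconj : conj (jacobiSum χ χ) = jacobiSum χ⁻¹ χ⁻¹ := by
    have hval : ∀ x, conj (χ x) = χ⁻¹ x := by
      intro x
      rw [hχinv, MulChar.pow_apply' _ two_ne_zero]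
      obtain ⟨a, rfl⟩ := Ideal.Quotient.mk_surjective x
      rw [show χ (Ideal.Quotient.mk (Ideal.span {π}) a) = primeSymbol a π from
        cubicChar_mk hπ h3 a]
      rcases primeSymbol_eq_zero_or hπ a with h | h
      · rw [h, map_zero, zero_pow two_ne_zero]
      · obtain ⟨i, -, hi⟩ := isPrimitiveRoot_eta.eq_pow_of_pow_eq_one h
        rw [← hi, map_pow, conj_eta, ← pow_mul, ← pow_mul, mul_comm]
    rw [jacobiSum, jacobiSum, map_sum]
    simp_rw [map_mul, hval]
  -- The product formula J(χ,χ) J(χ⁻¹,χ⁻¹) = Nπ is applied with values in the fraction field.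
  have hnorm : jacobiSum χ χ * conj (jacobiSum χ χ) = π * conj π := by
    rw [hconj, ← norm3_eq, ← hcard]
    let f := algebraMap ZZeta3 (CyclotomicField 3 ℚ)
    have hf : Function.Injective f := FaithfulSMul.algebraMap_injective _ _
    have hχ2 : χ * χ ≠ 1 := by
      rw [← pow_two, ← hχinv]
      exact inv_ne_one.2 hχ1
    have hchar : ringChar (CyclotomicField 3 ℚ) ≠ ringChar (ZZeta3 ⧸ Ideal.span {π}) := by
      rw [ringChar.eq_zero]
      exact (CharP.char_ne_zero_of_finite (ZZeta3 ⧸ Ideal.span {π})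
        (ringChar (ZZeta3 ⧸ Ideal.span {π}))).symm
    have := jacobiSum_mul_jacobiSum_inv (χ := χ.ringHomComp f) (φ := χ.ringHomComp f) hchar
      ((MulChar.ringHomComp_ne_one_iff hf).mpr hχ1) ((MulChar.ringHomComp_ne_one_iff hf).mpr hχ1)
      (by rw [← MulChar.ringHomComp_mul]; exact (MulChar.ringHomComp_ne_one_iff hf).mpr hχ2)
    apply hf
    rw [map_mul, ← jacobiSum_ringHomComp, ← jacobiSum_ringHomComp, map_natCast, ← this,
      MulChar.ringHomComp_inv]
  obtain ⟨c, hc⟩ := hdvd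
  rw [hc] at hnorm hprimJ ⊢
  have hπ' := (prime_conj hπ).ne_zero
  -- J = πc has the norm of π, so c is a unit; J and π are primary, so c is primary and therefore
  -- ±1.
  have hcu : IsUnit c := by
    refine IsUnit.of_mul_eq_one (conj c) ?_
    apply mul_left_cancel₀ (mul_ne_zero hπ.ne_zero hπ')
    rw [map_mul] at hnorm
    linear_combination hnorm
  have hcp : IsPrimary c := by
    rcases hprim with h | h
    · refine IsPrimary.of_dvd_sub (x := π * c) (.inr hprimJ) ?_
      convert h.mul_right c using 1; ring
    · refine IsPrimary.of_dvd_sub (x := -(π * c)) (IsPrimary.neg (.inr hprimJ)) ?_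
      rw [← dvd_neg]
      convert h.mul_right c using 1; ring
  rcases hcp.eq_one_or_neg_one hcu with rfl | rfl
  · left; ring
  · right; ring

/-- This is `cubic_gaussSum_relation` for the character modulo π with values reduced modulo π'. The
Jacobi sum is ±π, and the power (Nπ' − 1)/3 becomes a symbol modulo π'. -/
theorem primeSymbol_norm_mul_self_mul {π π' : ZZeta3} (hπ : Prime π) (hπ' : Prime π')
    (hp : IsPrimary π) (hp' : IsPrimary π') (hd : ¬ π' ∣ π * conj π) :
    primeSymbol (π * conj π * π) π' * primeSymbol (π' * conj π') π = 1 := by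
  have h3 := hp.not_dvd_three hπ dvd_rfl
  have h3' := hp'.not_dvd_three hπ' dvd_rfl
  have := isMaximal_span hπ
  let _ := Ideal.Quotient.field (Ideal.span {π})
  have := isMaximal_span hπ'
  let _ := Ideal.Quotient.field (Ideal.span {π'})
  have hfin : Finite (ZZeta3 ⧸ Ideal.span {π}) :=
    Ideal.finiteQuotientOfFreeOfNeBot _ (by simpa using hπ.ne_zero)
  let _ := Fintype.ofFinite (ZZeta3 ⧸ Ideal.span {π})
  have hfin' : Finite (ZZeta3 ⧸ Ideal.span {π'}) :=
    Ideal.finiteQuotientOfFreeOfNeBot _ (by simpa using hπ'.ne_zero)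
  let _ := Fintype.ofFinite (ZZeta3 ⧸ Ideal.span {π'})
  have hcard : Fintype.card (ZZeta3 ⧸ Ideal.span {π}) = norm3 π := by
    rw [← natCard_quotient, Nat.card_eq_fintype_card]
  have hcard' : Fintype.card (ZZeta3 ⧸ Ideal.span {π'}) = norm3 π' := by
    rw [← natCard_quotient, Nat.card_eq_fintype_card]
  let χ := cubicChar hπ h3
  let f := Ideal.Quotient.mk (Ideal.span {π'})
  -- Nπ = π · conj π is a power of the characteristic below π, so equal characteristics would force
  -- π' to divide it.
  have hchar : ringChar (ZZeta3 ⧸ Ideal.span {π'}) ≠ ringChar (ZZeta3 ⧸ Ideal.span {π}) := by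
    intro h
    obtain ⟨n, -, hc⟩ := FiniteField.card (ZZeta3 ⧸ Ideal.span {π})
      (ringChar (ZZeta3 ⧸ Ideal.span {π}))
    apply hd
    rw [← norm3_eq, ← hcard, hc, Nat.cast_pow]
    refine dvd_pow ?_ n.ne_zero
    rw [← mk_eq_zero, map_natCast, ← h]
    exact CharP.cast_eq_zero _ _
  have hχ1 : χ.ringHomComp f ≠ 1 := by
    obtain ⟨x, hx⟩ := MulChar.ne_one_iff.1 (cubicChar_ne_one hπ h3)
    refine MulChar.ne_one_iff.2 ⟨x, fun h => hx ?_⟩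
    have hx3 : cubicChar hπ h3 x ^ 3 = 1 := by
      rw [← MulChar.pow_apply_coe, cubicChar_pow_three, MulChar.one_apply_coe]
    refine eq_of_cube_eq_one_of_dvd_sub hπ' h3' hx3 (one_pow 3) ?_
    rw [← mk_eq_zero, map_sub, map_one, sub_eq_zero]
    exact h
  have hχ3 : χ.ringHomComp f ^ 3 = 1 := by
    rw [MulChar.ringHomComp_pow, cubicChar_pow_three, MulChar.ringHomComp_one]
  have key := cubic_gaussSum_relation hχ1 hχ3 hchar
    (by rw [hcard']; exact three_dvd_norm3_sub_one hπ' h3')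
  rw [jacobiSum_ringHomComp, MulChar.ringHomComp_apply, hcard, hcard', ← map_natCast f,
    ← map_natCast (Ideal.Quotient.mk (Ideal.span {π})), ← map_mul, ← map_pow, ← map_mul,
    cubicChar_mk hπ h3, norm3_eq, norm3_eq] at key
  have hpow : ∀ a, f (a ^ ((norm3 π' - 1) / 3)) = f (primeSymbol a π') := by
    intro a
    rw [← sub_eq_zero, ← map_sub, mk_eq_zero]
    exact dvd_pow_sub_primeSymbol hπ' h3' a
  rw [map_mul, hpow, ← map_mul] at key
  have hJ : primeSymbol (π * conj π * jacobiSum χ χ) π' = primeSymbol (π * conj π * π) π' := by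
    rcases jacobiSum_cubicChar hπ h3 hp with h | h
    · rw [show jacobiSum χ χ = π from h]
    · rw [show jacobiSum χ χ = -π from h, mul_neg, ← cubicSymbol_prime _ hπ',
        ← cubicSymbol_prime _ hπ', cubicSymbol_neg_left]
  rw [hJ] at key
  have hd' : ¬ π ∣ π' * conj π' := by
    intro h
    apply hd
    rcases hπ.dvd_or_dvd h with h | h
    · exact ((hπ.associated_of_dvd hπ' h).symm.dvd).mul_right _
    · have h2 := (hπ.associated_of_dvd (prime_conj hπ') h).symm.dvd
      rw [← conj_dvd_conj, conj_conj] at h2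
      exact h2.mul_left _
  have hd2 : ¬ π' ∣ π * conj π * π := by
    intro h
    exact hd ((hπ'.dvd_or_dvd h).elim id fun h => h.mul_right _)
  rw [mul_comm]
  refine eq_of_cube_eq_one_of_dvd_sub hπ' h3' ?_ (one_pow 3) ?_
  · rw [mul_pow, (isResidueRoot_primeSymbol hπ h3 hd').1,
      (isResidueRoot_primeSymbol hπ' h3' hd2).1, one_mul]
  · rw [← mk_eq_zero, map_sub, sub_eq_zero, map_one]
    exact key


theorem cubicSymbol_comm_of_not_dvd {π π' : ZZeta3} (hπ : Prime π) (hπ' : Prime π')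
    (hp : IsPrimary π) (hp' : IsPrimary π') (hd : ¬ π' ∣ π * conj π) :
    cubicSymbol π π' = cubicSymbol π' π := by
  have hd' : ¬ π ∣ π' * conj π' := by
    intro h
    apply hd
    rcases hπ.dvd_or_dvd h with h | h
    · exact ((hπ.associated_of_dvd hπ' h).symm.dvd).mul_right _
    · have h2 := (hπ.associated_of_dvd (prime_conj hπ') h).symm.dvd
      rw [← conj_dvd_conj, conj_conj] at h2
      exact h2.mul_left _
  have h1 := primeSymbol_norm_mul_self_mul hπ hπ' hp hp' hd
  have h2 := primeSymbol_norm_mul_self_mul hπ' hπ hp' hp hd'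
  rw [cubicSymbol_prime _ hπ, cubicSymbol_prime _ hπ']
  simp only [primeSymbol_mul hπ, primeSymbol_mul hπ'] at h1 h2
  -- The relation and its mirror image say that the same product, times [π/π'] and times [π'/π]
  -- respectively, equals 1.
  refine mul_left_cancel₀ (left_ne_zero_of_mul_eq_one (a := primeSymbol π π' *
    primeSymbol (conj π) π' * primeSymbol π' π * primeSymbol (conj π') π)
    (b := primeSymbol π π') ?_) ?_
  · linear_combination h1
  · linear_combination h1 - h2

/-- Only primes dividing t are required to satisfy reciprocity: for t = π + conj π it is not yet
available at all primes. -/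
theorem cubicSymbol_comm_of_forall_prime {π t : ZZeta3} (ht : IsPrimary t)
    (h : ∀ p, Prime p → IsPrimary p → p ∣ t → cubicSymbol p π = cubicSymbol π p) :
    cubicSymbol t π = cubicSymbol π t := by
  revert h
  refine IsPrimary.induction (P := fun t => (∀ p, Prime p → IsPrimary p → p ∣ t →
    cubicSymbol p π = cubicSymbol π p) → cubicSymbol t π = cubicSymbol π t) ?_ ?_ ?_ ht
  · intro _
    rw [cubicSymbol_one_left, cubicSymbol_of_isUnit _ isUnit_one]
  · intro x ih h
    rw [cubicSymbol_neg_left, cubicSymbol_neg_right,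
      ih fun p hp hp' hpx => h p hp hp' (hpx.trans (by simp))]
  · intro p x hp hp' hx ih h
    rw [cubicSymbol_mul_left, cubicSymbol_mul_right _ hp.ne_zero hx.ne_zero,
      h p hp hp' (dvd_mul_right _ _), ih fun q hq hq' hqx => h q hq hq' (hqx.mul_left _)]

/-- The two symbols are conjugate, so it suffices that [conj π/π] is fixed by conjugation. It equals
[t/π] = [π/t] for the primary self-conjugate t = π + conj π, and conj π ≡ −π mod t. -/
theorem cubicSymbol_conj_self {π : ZZeta3} (hπ : Prime π) (hp : IsPrimary π)
    (h : ¬ Associated π (conj π)) : cubicSymbol (conj π) π = cubicSymbol π (conj π) := by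
  have hπ' := prime_conj hπ
  have hnd : ¬ π ∣ conj π := fun hd => h (hπ.associated_of_dvd hπ' hd)
  have hnd' : ¬ conj π ∣ π := fun hd => h (hπ'.associated_of_dvd hπ hd).symm
  have ht : IsPrimary (π + conj π) := by
    rcases hp with ⟨a, ha⟩ | ⟨a, ha⟩
    · right
      rw [eq_add_of_sub_eq ha]
      simp only [map_add, map_mul, map_one, map_ofNat]
      exact ⟨a + conj a + 1, by ring⟩
    · left
      rw [eq_sub_of_add_eq ha]
      simp only [map_sub, map_mul, map_one, map_ofNat]
      exact ⟨a + conj a - 1, by ring⟩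
  have h1 : cubicSymbol (π + conj π) π = cubicSymbol π (π + conj π) := by
    refine cubicSymbol_comm_of_forall_prime ht fun p hq hq' hqt => ?_
    refine (cubicSymbol_comm_of_not_dvd hπ hq hp hq' fun hd => ?_).symm
    rcases hq.dvd_or_dvd hd with hd | hd
    · refine hnd ((hq.associated_of_dvd hπ hd).symm.dvd.trans ?_)
      exact (dvd_add_right hd).1 hqt
    · refine hnd' ((hq.associated_of_dvd hπ' hd).symm.dvd.trans ?_)
      exact (dvd_add_left hd).1 hqt
  have h2 : cubicSymbol (π + conj π) π = cubicSymbol (conj π) π :=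
    cubicSymbol_congr (by simp)
  have h3 : conj (cubicSymbol π (π + conj π)) = cubicSymbol π (π + conj π) := by
    rw [← cubicSymbol_conj, map_add, conj_conj, add_comm (conj π), ← cubicSymbol_neg_left π]
    exact cubicSymbol_congr (by rw [sub_neg_eq_add, add_comm])
  rw [← h1, h2, ← cubicSymbol_conj, conj_conj] at h3
  exact h3.symm

theorem cubicSymbol_comm_of_prime {π π' : ZZeta3} (hπ : Prime π) (hπ' : Prime π')
    (hp : IsPrimary π) (hp' : IsPrimary π') : cubicSymbol π π' = cubicSymbol π' π := by
  by_cases hd : π' ∣ π * conj π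
  swap
  · exact cubicSymbol_comm_of_not_dvd hπ hπ' hp hp' hd
  by_cases h1 : π' ∣ π
  · rw [cubicSymbol_prime _ hπ, cubicSymbol_prime _ hπ',
      primeSymbol_eq_zero (hp'.not_dvd_three hπ' dvd_rfl) h1,
      primeSymbol_eq_zero (hp.not_dvd_three hπ dvd_rfl) (hπ'.associated_of_dvd hπ h1).symm.dvd]
  -- In the remaining case π' and conj π are associated primary elements, hence equal up to sign.
  obtain ⟨u, hu⟩ := hπ'.associated_of_dvd (prime_conj hπ) ((hπ'.dvd_or_dvd hd).resolve_left h1)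
  have hup : IsPrimary (u : ZZeta3) := by
    rcases hp' with h | h
    · refine IsPrimary.of_dvd_sub hp.conj ?_
      rw [← hu]
      convert h.mul_right (u : ZZeta3) using 1; ring
    · refine IsPrimary.of_dvd_sub hp.conj.neg ?_
      rw [← hu, ← dvd_neg]
      convert h.mul_right (u : ZZeta3) using 1; ring
  have hna : ¬ Associated π (conj π) := fun h =>
    h1 ((Dvd.intro _ hu).trans h.symm.dvd)
  have := cubicSymbol_conj_self hπ hp hna
  rcases hup.eq_one_or_neg_one u.isUnit with h | h
  · rw [show π' = conj π by rw [← hu, h, mul_one], this]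
  · rw [show π' = -conj π by rw [← hu, h]; ring, cubicSymbol_neg_left, cubicSymbol_neg_right, this]

/-- **Cubic reciprocity** for primary, not necessarily prime or coprime, Eisenstein integers. -/
theorem IsPrimary.cubicSymbol_comm {a b : ZZeta3} (ha : IsPrimary a) (hb : IsPrimary b) :
    cubicSymbol a b = cubicSymbol b a := by
  refine IsPrimary.induction (P := fun b => cubicSymbol a b = cubicSymbol b a) ?_ ?_ ?_ hb
  · rw [cubicSymbol_one_left, cubicSymbol_of_isUnit _ isUnit_one]
  · intro x ih
    rw [cubicSymbol_neg_left, cubicSymbol_neg_right, ih]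
  · intro p x hp hp' hx ih
    rw [cubicSymbol_mul_left, cubicSymbol_mul_right _ hp.ne_zero hx.ne_zero, ih,
      cubicSymbol_comm_of_forall_prime ha fun q hq hq' _ =>
        cubicSymbol_comm_of_prime hq hp hq' hp']

/-! ### Periodicity of the symbol in the denominator -/

theorem pow_six_eq_one_of_isUnit {u : ZZeta3} (hu : IsUnit u) : u ^ 6 = 1 := by
  have h6 : eta ^ 6 = 1 := by rw [pow_mul eta 3 2, eta_pow_three, one_pow]
  obtain ⟨u, rfl⟩ := hu
  have h := IsCyclotomicExtension.Rat.Three.Units.mem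
    (IsCyclotomicExtension.zeta_spec 3 ℚ (CyclotomicField 3 ℚ)) u
  simp only [List.mem_cons, List.not_mem_nil, or_false] at h
  have hc : (((IsPrimitiveRoot.isUnit (IsCyclotomicExtension.zeta_spec 3 ℚ
    (CyclotomicField 3 ℚ)).toInteger_isPrimitiveRoot (by decide)).unit : ZZeta3ˣ) : ZZeta3) =
    eta := rfl
  rcases h with rfl | rfl | rfl | rfl | rfl | rfl
  · simp
  · rw [Units.val_neg, Even.neg_pow (by decide)]; simp
  · rw [hc, h6]
  · rw [Units.val_neg, hc, Even.neg_pow (by decide), h6]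
  · rw [Units.val_pow_eq_pow_val, hc, ← pow_mul, mul_comm, pow_mul, h6, one_pow]
  · rw [Units.val_neg, Even.neg_pow (by decide), Units.val_pow_eq_pow_val, hc, ← pow_mul,
      mul_comm, pow_mul, h6, one_pow]

/-- On norms congruent to 1 mod 3, N ↦ (N − 1)/3 mod 3 turns products into sums. The value depends
only on the norm mod 9, the source of the modulus 9 below. -/
theorem cubicSymbol_of_cube_eq_one {ξ a : ZZeta3} (hξ : ξ ^ 3 = 1) (ha : IsPrimary a) :
    cubicSymbol ξ a = ξ ^ ((norm3 a - 1) / 3) := by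
  have hu : IsUnit ξ := IsUnit.of_pow_eq_one hξ three_ne_zero
  have hN1 : norm3 1 = 1 := by simp [norm3]
  refine (IsPrimary.induction (P := fun a => IsPrimary a ∧
    cubicSymbol ξ a = ξ ^ ((norm3 a - 1) / 3)) ?_ ?_ ?_ ha).2
  · exact ⟨.inl (by simp), by rw [cubicSymbol_of_isUnit _ isUnit_one, hN1]; simp⟩
  · rintro x ⟨hx, ih⟩
    refine ⟨hx.neg, ?_⟩
    rw [cubicSymbol_neg_right, ih, norm3_eq_of_associated (Associated.neg_left (Associated.refl x))]
  · rintro p x hp hp' hx ⟨-, ih⟩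
    refine ⟨hp'.mul hx, ?_⟩
    have h3 := hp'.not_dvd_three hp dvd_rfl
    have hξp : cubicSymbol ξ p = ξ ^ ((norm3 p - 1) / 3) := by
      rw [cubicSymbol_prime _ hp]
      refine primeSymbol_eq hp h3 (fun h => hp.not_isUnit (isUnit_of_dvd_unit h hu)) ⟨?_, by simp⟩
      rw [← pow_mul, mul_comm, pow_mul, hξ, one_pow]
    rw [cubicSymbol_mul_right _ hp.ne_zero hx.ne_zero, ih, hξp, norm3_mul]
    have h1 := hp'.three_dvd_norm3_sub_one
    have h2 := hx.three_dvd_norm3_sub_one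
    obtain ⟨m, hm⟩ : ∃ m, norm3 p = 3 * m + 1 := ⟨norm3 p / 3, by omega⟩
    obtain ⟨n, hn⟩ : ∃ n, norm3 x = 3 * n + 1 := ⟨norm3 x / 3, by omega⟩
    rw [hm, hn, show (3 * m + 1) * (3 * n + 1) = 3 * (3 * (m * n) + m + n) + 1 by ring]
    simp only [Nat.add_sub_cancel, Nat.mul_div_cancel_left _ (by norm_num : 0 < 3)]
    rw [pow_add, pow_add, pow_mul, hξ, one_pow, one_mul]

theorem nine_dvd_norm3_sub {a b : ZZeta3} (h : (9 : ZZeta3) ∣ a - b) :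
    (9 : ℤ) ∣ norm3 a - norm3 b := by
  rw [← intCast_dvd_intCast]
  push_cast
  rw [norm3_eq, norm3_eq]
  have h' : (9 : ZZeta3) ∣ conj a - conj b := by
    rw [← map_sub, ← map_ofNat conj 9]
    exact conj_dvd_conj.2 h
  convert dvd_add (h.mul_right (conj a)) (h'.mul_left b) using 1
  ring

/-- A symbol is thus recovered from its square, which allows u to be replaced by u² for units and η
− 1 by its square −3η. -/
theorem cubicSymbol_pow_four (a l : ZZeta3) : cubicSymbol a l ^ 4 = cubicSymbol a l := by
  rcases cubicSymbol_eq_zero_or a l with h | h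
  · rw [h]; norm_num
  · rw [pow_succ, h, one_mul]

theorem cubicSymbol_unit_congr {u a b : ZZeta3} (hu : IsUnit u) (ha : IsPrimary a)
    (hb : IsPrimary b) (hab : (9 : ZZeta3) ∣ a - b) : cubicSymbol u a = cubicSymbol u b := by
  have hξ : (u ^ 2) ^ 3 = 1 := by rw [← pow_mul, pow_six_eq_one_of_isUnit hu]
  have h : cubicSymbol (u ^ 2) a = cubicSymbol (u ^ 2) b := by
    rw [cubicSymbol_of_cube_eq_one hξ ha, cubicSymbol_of_cube_eq_one hξ hb]
    have h1 := ha.three_dvd_norm3_sub_one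
    have h2 := hb.three_dvd_norm3_sub_one
    have h3 := nine_dvd_norm3_sub hab
    exact pow_eq_pow_of_modEq (n := 3) (by unfold Nat.ModEq; omega) hξ
  rw [← cubicSymbol_pow_four u a, ← cubicSymbol_pow_four u b, pow_mul _ 2 2, pow_mul _ 2 2,
    ← cubicSymbol_pow_left, ← cubicSymbol_pow_left u b, h]

/-- Modulo 1 + 3x one has 3x ≡ −1, so [3x/(1 + 3x)] = 1; by reciprocity [ux/(1 + 3x)] = [(1 +
3x)/(ux)] = 1. Cancelling [x/(1 + 3x)] leaves a symbol of a unit. -/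
theorem cubicSymbol_three_eq {x u : ZZeta3} (hu : IsUnit u) (hux : IsPrimary (u * x)) :
    cubicSymbol 3 (1 + 3 * x) = cubicSymbol u (1 + 3 * x) := by
  have hp : IsPrimary (1 + 3 * x) := .inl ⟨x, by ring⟩
  have h1 : cubicSymbol (3 * x) (1 + 3 * x) = 1 := by
    refine (cubicSymbol_congr (b := -1) ⟨1, by ring⟩).trans ?_
    rw [cubicSymbol_neg_left, cubicSymbol_one_left]
  have h2 : cubicSymbol (u * x) (1 + 3 * x) = 1 := by
    rw [hux.cubicSymbol_comm hp]
    refine (cubicSymbol_congr ?_).trans (cubicSymbol_one_left (u * x))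
    rw [add_sub_cancel_left, hu.mul_left_dvd]
    exact dvd_mul_left _ _
  rw [cubicSymbol_mul_left] at h1 h2
  exact mul_right_cancel₀ (right_ne_zero_of_mul_eq_one h1) (h1.trans h2.symm)

theorem cubicSymbol_three_congr {a b : ZZeta3} (ha : IsPrimary a) (hab : (9 : ZZeta3) ∣ a - b) :
    cubicSymbol 3 a = cubicSymbol 3 b := by
  have h0 : ∀ x y : ZZeta3, ¬ (eta - 1) ∣ x → (3 : ZZeta3) ∣ x - y →
      cubicSymbol 3 (1 + 3 * x) = cubicSymbol 3 (1 + 3 * y) := by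
    intro x y hx hxy
    obtain ⟨u, hu, hux⟩ := exists_unit_mul_isPrimary hx
    have huy : IsPrimary (u * y) := hux.of_dvd_sub (by rw [← mul_sub]; exact hxy.mul_left u)
    rw [cubicSymbol_three_eq hu hux, cubicSymbol_three_eq hu huy]
    refine cubicSymbol_unit_congr hu (.inl ⟨x, by ring⟩) (.inl ⟨y, by ring⟩) ?_
    obtain ⟨c, hc⟩ := hxy
    exact ⟨c, by linear_combination 3 * hc⟩
  have h1 : ∀ x y : ZZeta3, (3 : ZZeta3) ∣ x - y →
      cubicSymbol 3 (1 + 3 * x) = cubicSymbol 3 (1 + 3 * y) := by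
    intro x y hxy
    by_cases hx : (eta - 1) ∣ x
    swap
    · exact h0 x y hx hxy
    -- If η − 1 divides x, it does not divide 1 + 4x, and 1 + 3(1 + 4x) = 4(1 + 3x) reduces to the
    -- previous case.
    have h4 : cubicSymbol (3 : ZZeta3) 4 ≠ 0 := cubicSymbol_ne_zero ⟨-1, 1, by norm_num⟩
    have hz : ∀ z : ZZeta3, cubicSymbol 3 (1 + 3 * (1 + 4 * z)) =
        cubicSymbol 3 4 * cubicSymbol 3 (1 + 3 * z) := by
      intro z
      rw [← cubicSymbol_mul_right _ (by norm_num) (IsPrimary.ne_zero (.inl ⟨z, by ring⟩))]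
      congr 1
      ring
    refine mul_left_cancel₀ h4 ?_
    rw [← hz, ← hz]
    refine h0 _ _ (fun h => ?_) ?_
    · refine prime_lambda.not_isUnit (isUnit_of_dvd_one ?_)
      exact (dvd_add_left (hx.mul_left 4)).1 h
    · obtain ⟨c, hc⟩ := hxy
      exact ⟨4 * c, by linear_combination 4 * hc⟩
  obtain ⟨c, hc⟩ := hab
  rcases ha with ⟨x, hx⟩ | ⟨x, hx⟩
  · rw [show a = 1 + 3 * x by linear_combination hx,
      show b = 1 + 3 * (x - 3 * c) by linear_combination hx - hc]
    exact h1 _ _ ⟨c, by ring⟩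
  · rw [← cubicSymbol_neg_right 3 a, ← cubicSymbol_neg_right 3 b,
      show -a = 1 + 3 * -x by linear_combination -hx,
      show -b = 1 + 3 * (-x + 3 * c) by linear_combination hc - hx]
    exact h1 _ _ ⟨-c, by ring⟩

theorem cubicSymbol_lambda_congr {a b : ZZeta3} (ha : IsPrimary a) (hb : IsPrimary b)
    (hab : (9 : ZZeta3) ∣ a - b) : cubicSymbol (eta - 1) a = cubicSymbol (eta - 1) b := by
  have h : cubicSymbol ((eta - 1) ^ 2) a = cubicSymbol ((eta - 1) ^ 2) b := by
    rw [lambda_sq, neg_mul, cubicSymbol_neg_left, cubicSymbol_neg_left, cubicSymbol_mul_left,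
      cubicSymbol_mul_left, cubicSymbol_three_congr ha hab,
      cubicSymbol_unit_congr isUnit_eta ha hb hab]
  rw [← cubicSymbol_pow_four _ a, ← cubicSymbol_pow_four _ b, pow_mul _ 2 2, pow_mul _ 2 2,
    ← cubicSymbol_pow_left, ← cubicSymbol_pow_left _ b, h]

/-- The symbol `[t / a]` is periodic in the primary denominator `a`. -/
theorem cubicSymbol_right_congr {t a b : ZZeta3} (ha : IsPrimary a) (hb : IsPrimary b)
    (hab : (9 : ZZeta3) ∣ a - b) (ht : t ∣ a - b) : cubicSymbol t a = cubicSymbol t b := by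
  induction t using UniqueFactorizationMonoid.induction_on_prime with
  | h₁ => rw [sub_eq_zero.1 (zero_dvd_iff.1 ht)]
  | h₂ t h => exact cubicSymbol_unit_congr h ha hb hab
  | h₃ t p _ hp ih =>
    rw [cubicSymbol_mul_left, cubicSymbol_mul_left, ih ((dvd_mul_left _ _).trans ht)]
    congr 1
    by_cases h3 : p ∣ 3
    · obtain ⟨u, rfl⟩ := ((dvd_three_iff hp).1 h3).symm
      rw [cubicSymbol_mul_left, cubicSymbol_mul_left, cubicSymbol_lambda_congr ha hb hab,
        cubicSymbol_unit_congr u.isUnit ha hb hab]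
    · obtain ⟨u, hu, hup⟩ := exists_unit_mul_isPrimary (x := p) fun h =>
        h3 ((dvd_three_iff hp).2 (prime_lambda.associated_of_dvd hp h).symm)
      have h1 : cubicSymbol (u * p) a = cubicSymbol (u * p) b := by
        rw [hup.cubicSymbol_comm ha, hup.cubicSymbol_comm hb]
        refine cubicSymbol_congr ?_
        rw [hu.mul_left_dvd]
        exact (dvd_mul_right _ _).trans ht
      rw [cubicSymbol_mul_left, cubicSymbol_mul_left, cubicSymbol_unit_congr hu ha hb hab] at h1
      exact mul_left_cancel₀ (cubicSymbol_ne_zero (isCoprime_of_irreducible_dvd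
        (fun h => hb.ne_zero h.2) fun z hz hzu _ => hz.not_isUnit (isUnit_of_dvd_unit hzu hu))) h1

/-! ### Twisted multiplicativity of the cubic spin -/

theorem IsPrimary.of_mul_left {x y : ZZeta3} (hx : IsPrimary x) (hxy : IsPrimary (x * y)) :
    IsPrimary y := by
  rcases hx with h | h
  · refine hxy.of_dvd_sub ?_
    convert h.mul_right y using 1; ring
  · refine hxy.neg.of_dvd_sub ?_
    rw [← dvd_neg]
    convert h.mul_right y using 1; ring

theorem IsPrimary.three_dvd_of_mul {x y : ZZeta3} (hx : IsPrimary x) (h : (3 : ZZeta3) ∣ x * y) :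
    (3 : ZZeta3) ∣ y := by
  rcases hx with hx | hx
  · convert dvd_sub h (hx.mul_right y) using 1; ring
  · convert dvd_sub (hx.mul_right y) h using 1; ring

theorem exists_primary_gcd {u : ZZeta3} (hu : IsPrimary u) (s : ZZeta3) :
    ∃ d a b : ZZeta3, IsPrimary d ∧ IsCoprime a b ∧ u = d * a ∧ s = d * b := by
  obtain ⟨x, y, hxy⟩ := IsBezout.gcd_eq_sum u s
  obtain ⟨a, ha⟩ := IsBezout.gcd_dvd_left u s
  obtain ⟨b, hb⟩ := IsBezout.gcd_dvd_right u s
  generalize IsBezout.gcd u s = d at *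
  have hd0 : d ≠ 0 := fun h => hu.ne_zero (by rw [ha, h, zero_mul])
  have hab : x * a + y * b = 1 := by
    apply mul_left_cancel₀ hd0
    linear_combination hxy - x * ha - y * hb
  obtain ⟨e, ⟨e, rfl⟩, hed⟩ := exists_unit_mul_isPrimary fun h =>
    hu.not_lambda_dvd (h.trans (Dvd.intro _ ha.symm))
  have he : (e : ZZeta3) * ↑e⁻¹ = 1 := e.mul_inv
  refine ⟨e * d, ↑e⁻¹ * a, ↑e⁻¹ * b, hed, ⟨e * x, e * y, ?_⟩, ?_, ?_⟩
  · linear_combination (x * a + y * b) * he + hab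
  · linear_combination ha - d * a * he
  · linear_combination hb - d * b * he

/-- The gcd d is removed because s and r need not be coprime to u: [v/a], [b/a] and [d/n] are then
nonzero and can be cancelled. -/
theorem cubicSymbol_mul_formula {u v r s u' ω : ZZeta3} (hu : IsPrimary u) (hr : IsPrimary r)
    (hv : (3 : ZZeta3) ∣ v) (hs : (3 : ZZeta3) ∣ s) (huv : IsCoprime u v)
    (hu' : u ^ 2 + v ^ 2 ∣ u * u' - 1) (hω : u ^ 2 + v ^ 2 ∣ ω - -v * u') :
    cubicSymbol (u * s + v * r) (u * r - v * s) =
      cubicSymbol v u * cubicSymbol s r * cubicSymbol (r + ω * s) (u ^ 2 + v ^ 2) := by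
  obtain ⟨d, a, b, hd, hab, rfl, rfl⟩ := exists_primary_gcd hu s
  have ha : IsPrimary a := hd.of_mul_left hu
  have hb : (3 : ZZeta3) ∣ b := hd.three_dvd_of_mul hs
  have hR : IsPrimary (a * r - v * b) :=
    (ha.mul hr).of_dvd_sub (by rw [sub_sub_cancel]; exact hv.mul_right b)
  have hn : IsPrimary ((d * a) ^ 2 + v ^ 2) := by
    rw [pow_two (d * a)]
    refine (hu.mul hu).of_dvd_sub ?_
    rw [sub_add_cancel_left, dvd_neg]
    exact dvd_pow hv two_ne_zero
  have hdv : IsCoprime d v := huv.of_mul_left_left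
  have hav : IsCoprime a v := huv.of_mul_left_right
  have hdn : IsCoprime d ((d * a) ^ 2 + v ^ 2) := by
    rw [show (d * a) ^ 2 + v ^ 2 = v ^ 2 + d * (d * a ^ 2) by ring]
    exact (IsCoprime.add_mul_left_right_iff).2 hdv.pow_right
  set n := (d * a) ^ 2 + v ^ 2 with hn_def
  have hva0 := cubicSymbol_ne_zero hav.symm
  have hba0 := cubicSymbol_ne_zero hab.symm
  have hdn0 := cubicSymbol_ne_zero hdn
  have hfact : d * a * r - v * (d * b) = d * (a * r - v * b) := by ring
  have h1 : cubicSymbol (d * a * (d * b) + v * r) d = cubicSymbol v d * cubicSymbol r d := by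
    rw [← cubicSymbol_mul_left]
    exact cubicSymbol_congr ⟨a * (d * b), by ring⟩
  -- With R = ar − vb this rests on a(us + vr) = bn + vR.
  have h2 : cubicSymbol a (a * r - v * b) *
      cubicSymbol (d * a * (d * b) + v * r) (a * r - v * b) =
      cubicSymbol b (a * r - v * b) * cubicSymbol n (a * r - v * b) := by
    rw [← cubicSymbol_mul_left, ← cubicSymbol_mul_left]
    exact cubicSymbol_congr ⟨v, by rw [hn_def]; ring⟩
  have h3 : cubicSymbol a (a * r - v * b) = cubicSymbol v a * cubicSymbol b a := by
    rw [ha.cubicSymbol_comm hR, ← cubicSymbol_mul_left, ← cubicSymbol_neg_left (v * b)]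
    exact cubicSymbol_congr ⟨r, by ring⟩
  have h4 : cubicSymbol n (a * r - v * b) = cubicSymbol (a * r - v * b) n :=
    hn.cubicSymbol_comm hR
  -- dR = ur − vs ≡ u(r + ωs) mod n, since uω ≡ −v.
  have h5 : cubicSymbol d n * cubicSymbol (a * r - v * b) n =
      cubicSymbol d n * cubicSymbol a n * cubicSymbol (r + ω * (d * b)) n := by
    rw [← cubicSymbol_mul_left, ← cubicSymbol_mul_left, ← cubicSymbol_mul_left]
    obtain ⟨p, hp⟩ := hu'
    obtain ⟨q, hq⟩ := hω
    exact cubicSymbol_congr ⟨(v * p - d * a * q) * (d * b), by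
      linear_combination (v * hp - d * a * hq) * (d * b)⟩
  have h7 : cubicSymbol a n = cubicSymbol v a ^ 2 := by
    rw [ha.cubicSymbol_comm hn, ← cubicSymbol_pow_left]
    exact cubicSymbol_congr ⟨d ^ 2 * a, by rw [hn_def]; ring⟩
  have h8 : cubicSymbol b (a * r - v * b) = cubicSymbol b a * cubicSymbol b r := by
    rw [← cubicSymbol_mul_right _ ha.ne_zero hr.ne_zero]
    -- The difference R − ar = −vb is divisible by b, and by 9 because 3 divides both v and b.
    refine cubicSymbol_right_congr hR (ha.mul hr) ?_ ⟨-v, by ring⟩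
    rw [sub_sub_cancel_left, dvd_neg, show (9 : ZZeta3) = 3 * 3 by norm_num]
    exact mul_dvd_mul hv hb
  rw [h7, mul_assoc] at h5
  have h5' := mul_left_cancel₀ hdn0 h5
  rw [h3, h4, h5', h8] at h2
  have hX : cubicSymbol (d * a * (d * b) + v * r) (a * r - v * b) =
      cubicSymbol b r * cubicSymbol v a * cubicSymbol (r + ω * (d * b)) n := by
    apply mul_left_cancel₀ (mul_ne_zero hva0 hba0)
    linear_combination h2
  rw [hfact, cubicSymbol_mul_right _ hd.ne_zero hR.ne_zero, h1, hX,
    cubicSymbol_mul_right _ hd.ne_zero ha.ne_zero, cubicSymbol_mul_left d b r,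
    hd.cubicSymbol_comm hr]
  ring

theorem IsPrimary.re_im {z : ZZeta12} (hz : IsPrimary z) :
    IsPrimary z.re ∧ (3 : ZZeta3) ∣ z.im := by
  have hre : ∀ c : ZZeta12, ((3 : ZZeta12) * c).re = 3 * c.re := fun c => by
    rw [show (3 : ZZeta12) * c = c + c + c by ring]
    simp only [QuadraticAlgebra.re_add]; ring
  have him : ∀ c : ZZeta12, ((3 : ZZeta12) * c).im = 3 * c.im := fun c => by
    rw [show (3 : ZZeta12) * c = c + c + c by ring]
    simp only [QuadraticAlgebra.im_add]; ring
  rcases hz with ⟨c, hc⟩ | ⟨c, hc⟩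
  · have h1 := congrArg QuadraticAlgebra.re hc
    have h2 := congrArg QuadraticAlgebra.im hc
    rw [hre] at h1
    rw [him] at h2
    simp only [QuadraticAlgebra.re_sub, QuadraticAlgebra.im_sub, QuadraticAlgebra.re_one,
      QuadraticAlgebra.im_one, sub_zero] at h1 h2
    exact ⟨.inl ⟨_, h1⟩, ⟨_, h2⟩⟩
  · have h1 := congrArg QuadraticAlgebra.re hc
    have h2 := congrArg QuadraticAlgebra.im hc
    rw [hre] at h1
    rw [him] at h2
    simp only [QuadraticAlgebra.re_add, QuadraticAlgebra.im_add, QuadraticAlgebra.re_one,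
      QuadraticAlgebra.im_one, add_zero] at h1 h2
    exact ⟨.inr ⟨_, h1⟩, ⟨_, h2⟩⟩

/-- The twisted multiplicativity of the cubic spin. -/
theorem spin_mul {w z : ZZeta12} (hw : IsPrimary w) (hz : IsPrimary z) (hwp : IsPrimitive w) :
    spin (w * z) = spin w * spin z * twistSymbol z w := by
  obtain ⟨ω, hω⟩ := exists_isOmega hwp
  obtain ⟨u', hu', hω'⟩ := id hω
  rw [twistSymbol_eq hω]
  have h := cubicSymbol_mul_formula hw.re_im.1 hz.re_im.1 hw.re_im.2 hz.re_im.2 hwp hu' hω'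
  have hre : (w * z).re = w.re * z.re - w.im * z.im := by
    simp only [QuadraticAlgebra.re_mul]; ring
  have him : (w * z).im = w.re * z.im + w.im * z.re := by
    simp only [QuadraticAlgebra.im_mul]; ring
  rw [spin, hre, him, h]
  rfl

/-- Expanding the spin of wz = zw in both orders leaves the two twists after cancelling the spins,
which primitivity makes nonzero. -/
theorem twistSymbol_comm {w z : ZZeta12} (hw : IsPrimary w) (hwp : IsPrimitive w)
    (hz : IsPrimary z) (hzp : IsPrimitive z) : twistSymbol z w = twistSymbol w z := by
  have h1 := spin_mul hw hz hwp
  rw [mul_comm w z, spin_mul hz hw hzp, mul_comm (spin z)] at h1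
  exact (mul_left_cancel₀ (mul_ne_zero (cubicSymbol_ne_zero hwp.symm)
    (cubicSymbol_ne_zero hzp.symm)) h1).symm

end CubicSpin

theorem mainTheorem4 :
    (∀ w z : CubicSpin.ZZeta12,
      CubicSpin.IsPrimary w → CubicSpin.IsPrimary z → CubicSpin.IsPrimitive w →
        CubicSpin.spin (w * z) =
          CubicSpin.spin w * CubicSpin.spin z * CubicSpin.twistSymbol z w) ∧
    (∀ w z : CubicSpin.ZZeta12,
      CubicSpin.IsPrimary w → CubicSpin.IsPrimitive w →
      CubicSpin.IsPrimary z → CubicSpin.IsPrimitive z →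
        CubicSpin.twistSymbol z w = CubicSpin.twistSymbol w z) :=
  ⟨fun _ _ hw hz hwp => CubicSpin.spin_mul hw hz hwp,
    fun _ _ hw hwp hz hzp => CubicSpin.twistSymbol_comm hw hwp hz hzp⟩
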